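/- Let $T>0$ and let $f,g,\sigma:\mathbb R_+\times[0,1]\times\mathbb R\to\mathbb R$ be Borel functions such that, for some constants $K,L,M$ and all $t\in[0,T]$, $x\in[0,1]$, $r,p,q\in\mathbb R$: (H1) $|f(t,x,r)|\le K(1+|r|)$; (H2) $g(t,x,r)=g_1(t,x,r)+g_2(t,r)$ with Borel functions $g_1,g_2$ satisfying $|g_1(t,x,r)|\le K(1+|r|)$ and $|g_2(t,r)|\le K(1+|r|^2)$; (H3) $|\sigma(t,x,r)|\le M$, $|\sigma(t,x,p)-\sigma(t,x,q)|\le L|p-q|$, $|f(t,x,p)-f(t,x,q)|\le L(1+|p|+|q|)|p-q|$ and $|g(t,x,p)-g(t,x,q)|\le L(1+|p|+|q|)|p-q|$. Let $G_t(x,y)=2\sum_{n\ge1}e^{-n^2\pi^2t}\sin(n\pi x)\sin(n\pi y)$, $t>0$, be the Green kernel of $\partial_t-\partial_x^2$ on $[0,1]$ with Dirichlet boundary conditions. Then for every $\eta\in L^2([0,1])$ and $v\in L^2([0,T]\times[0,1])$ there exists a unique $h\in C([0,T];L^2([0,1]))$ with $h(0)=\eta$ such that, for every $t\in(0,T]$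 and almost every $x\in[0,1]$, $$ \begin{aligned} h(t,x)={}&\int_0^1 G_t(x,y)\eta(y)\,dy-\int_0^t\!\int_0^1\partial_yG_{t-s}(x,y)\,g(s,y,h(s,y))\,dy\,ds\\ &+\int_0^t\!\int_0^1G_{t-s}(x,y)\,f(s,y,h(s,y))\,dy\,ds+\int_0^t\!\int_0^1G_{t-s}(x,y)\,\sigma(s,y,h(s,y))\,v(s,y)\,dy\,ds, \end{aligned} $$ where all the integrals converge absolutely. -/

import Mathlib

open MeasureTheory Set

noncomputable section

/-- The space `L²([0,1])`. -/
abbrev L2I : Type := Lp ℝ 2 (volume.restrict (Icc (0 : ℝ) 1))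

/-- The space `L²([0,T] × [0,1])`. -/
abbrev L2TI (T : ℝ) : Type :=
  Lp ℝ 2 ((volume : Measure (ℝ × ℝ)).restrict (Icc (0 : ℝ) T ×ˢ Icc (0 : ℝ) 1))

/-- The Green kernel `G_t(x,y)`, `t > 0`, of `∂/∂t - ∂²/∂x²` on `[0,1]` with homogeneous Dirichlet
boundary conditions: `G_t(x,y) = ∑_{n ≥ 1} 2 exp(-n²π²t) sin(nπx) sin(nπy)`. -/
def greenKernel (t x y : ℝ) : ℝ :=
  ∑' n : ℕ, 2 * Real.exp (-(((n : ℝ) + 1) ^ 2 * Real.pi ^ 2 * t)) *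
    Real.sin (((n : ℝ) + 1) * Real.pi * x) * Real.sin (((n : ℝ) + 1) * Real.pi * y)

/-- The derivative `∂_y G_t(x,y)`. -/
def greenKernelDy (t x y : ℝ) : ℝ := deriv (fun z => greenKernel t x z) y

/-- The iterated integral `∫₀ᵗ ∫₀¹ F(s,y) dy ds`. -/
def iterInt (F : ℝ → ℝ → ℝ) (t : ℝ) : ℝ :=
  ∫ s in Ioo (0 : ℝ) t, ∫ y in Icc (0 : ℝ) 1, F s y

/-- The iterated integral `∫₀ᵗ ∫₀¹ F(s,y) dy ds` converges absolutely. It is phrased through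
sections, so that it depends only on the almost everywhere class of `F(s,·)` for each `s`. -/
def IterIntegrable (F : ℝ → ℝ → ℝ) (t : ℝ) : Prop :=
  (∀ᵐ s ∂(volume.restrict (Ioo (0 : ℝ) t)), IntegrableOn (F s) (Icc (0 : ℝ) 1)) ∧
  IntegrableOn (fun s => ∫ y in Icc (0 : ℝ) 1, F s y) (Ioo (0 : ℝ) t) ∧
  IntegrableOn (fun s => ∫ y in Icc (0 : ℝ) 1, |F s y|) (Ioo (0 : ℝ) t)

/-- `h ∈ C([0,T]; L²([0,1]))` satisfies the skeleton equation
`h(t,x) = ∫ G_t(x,y) η(y) dy - ∫∫ ∂_y G_{t-s}(x,y) g(s,y,h(s,y)) dy ds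
  + ∫∫ G_{t-s}(x,y) f(s,y,h(s,y)) dy ds + ∫∫ G_{t-s}(x,y) σ(s,y,h(s,y)) v(s,y) dy ds`
for every `t ∈ (0,T]` as an identity in `L²([0,1])`, that is, for almost every `x`, with absolutely
convergent integrals; at `t = 0`, where `G_0` is the identity operator, the equation reads
`h(0) = η`. The extension `IccExtend` only makes `h(s)` meaningful for a real number `s`; it is
evaluated at `s ∈ [0,T]` only. -/
def IsSkeletonSolution {T : ℝ} (hT : 0 ≤ T) (f g σ : ℝ → ℝ → ℝ → ℝ) (η : L2I) (v : L2TI T)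
    (h : C(Icc (0 : ℝ) T, L2I)) : Prop :=
  h ⟨0, left_mem_Icc.mpr hT⟩ = η ∧
  ∀ t : Icc (0 : ℝ) T, 0 < (t : ℝ) → ∀ᵐ x ∂(volume.restrict (Icc (0 : ℝ) 1)),
    let u : ℝ → ℝ → ℝ := fun s y => IccExtend hT h s y
    let Fg : ℝ → ℝ → ℝ := fun s y => greenKernelDy (t - s) x y * g s y (u s y)
    let Ff : ℝ → ℝ → ℝ := fun s y => greenKernel (t - s) x y * f s y (u s y)
    let Fσ : ℝ → ℝ → ℝ := fun s y => greenKernel (t - s) x y * (σ s y (u s y) * v (s, y))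
    IterIntegrable Fg t ∧ IterIntegrable Ff t ∧ IterIntegrable Fσ t ∧
    h t x = (∫ y in Icc (0 : ℝ) 1, greenKernel t x y * η y)
      - iterInt Fg t + iterInt Ff t + iterInt Fσ t

end

/-!
In the coordinates `c_n(t) = ⟪e_n, h(t)⟫` of the sine basis the integral equation becomes the mild
form of `c_n' = -k_n² c_n + a_n(t, h)`, where `k_n = (n + 1) π` and `|a_n(t, w)|` is at most a
multiple of `k_n + ‖v(t,·)‖` on bounded sets of `w`, and likewise for differences. Truncating `w`
to a ball makes the nonlinearity globally Lipschitz, and the truncated equation is solved by a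
contraction in an exponentially weighted supremum norm.

The truncation is removed by an energy estimate. For Galerkin approximations, the quadratic part of
the flux contributes `∫ g(t,0,h) ∂_x h`, which vanishes because `h` has equal boundary values; what
is left grows at most linearly, so Grönwall's inequality gives a bound independent of the
truncation radius, and the bound passes to the limit.

Finally the singularities of `G` and `∂_y G` at `s = t` are integrable against the sources in `L¹`
in space, so that Fubini's theorem yields absolute convergence for almost every `x` and identifies
the sine coefficients of the right-hand side with the mild form.
-/

open Filter Topology

section CauchySchwarz

variable {α : Type*} [MeasurableSpace α] {μ : Measure α} {p q : α → ℝ}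

theorem integral_abs_mul_abs_le_sqrt_mul_sqrt (hp : MemLp p 2 μ) (hq : MemLp q 2 μ) :
    ∫ x, |p x| * |q x| ∂μ ≤ √(∫ x, p x ^ 2 ∂μ) * √(∫ x, q x ^ 2 ∂μ) := by
  simpa [Real.sqrt_eq_rpow] using
    integral_mul_norm_le_Lp_mul_Lq Real.HolderConjugate.two_two (μ := μ) (f := p) (g := q)
      (by simpa using hp) (by simpa using hq)

theorem sq_integral_mul_le (hp : MemLp p 2 μ) (hq : MemLp q 2 μ) :
    (∫ x, p x * q x ∂μ) ^ 2 ≤ (∫ x, p x ^ 2 ∂μ) * ∫ x, q x ^ 2 ∂μ := by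
  have habs : |∫ x, p x * q x ∂μ| ≤ √(∫ x, p x ^ 2 ∂μ) * √(∫ x, q x ^ 2 ∂μ) := by
    refine abs_integral_le_integral_abs.trans ?_
    simpa only [abs_mul] using integral_abs_mul_abs_le_sqrt_mul_sqrt hp hq
  rw [← Real.sqrt_mul (integral_nonneg fun x => sq_nonneg _)] at habs
  rw [← sq_abs]
  exact (Real.le_sqrt (abs_nonneg _) (mul_nonneg (integral_nonneg fun x => sq_nonneg _)
    (integral_nonneg fun x => sq_nonneg _))).1 habs

end CauchySchwarz

section Duhamel

/-- The variation of constants formula: the solution at time `t` of the scalar equation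
`c' = -m c + α` with initial value `c(0) = c₀`. -/
noncomputable def duhamel (m c₀ : ℝ) (α : ℝ → ℝ) (t : ℝ) : ℝ :=
  Real.exp (-(m * t)) * c₀ + ∫ s in (0 : ℝ)..t, Real.exp (-(m * (t - s))) * α s

variable {m c₀ t : ℝ} {α β V : ℝ → ℝ}

theorem intervalIntegrable_exp_mul (hα : IntervalIntegrable α volume 0 t) :
    IntervalIntegrable (fun s => Real.exp (-(m * (t - s))) * α s) volume 0 t :=
  hα.continuousOn_mul (by fun_prop)

@[simp]
theorem duhamel_zero_right (m c₀ : ℝ) (α : ℝ → ℝ) : duhamel m c₀ α 0 = c₀ := by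
  simp [duhamel]

theorem duhamel_const_mul (m r : ℝ) (α : ℝ → ℝ) (t : ℝ) :
    duhamel m 0 (fun s => r * α s) t = r * duhamel m 0 α t := by
  simp only [duhamel, mul_zero, zero_add, ← intervalIntegral.integral_const_mul, mul_left_comm]

theorem duhamel_add {d₀ : ℝ} (hα : IntervalIntegrable α volume 0 t)
    (hβ : IntervalIntegrable β volume 0 t) :
    duhamel m (c₀ + d₀) (fun s => α s + β s) t = duhamel m c₀ α t + duhamel m d₀ β t := by
  rw [duhamel, duhamel, duhamel, add_add_add_comm, ← mul_add,
    ← intervalIntegral.integral_add (intervalIntegrable_exp_mul hα) (intervalIntegrable_exp_mul hβ)]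
  simp only [← mul_add]

theorem duhamel_sub {d₀ : ℝ} (hα : IntervalIntegrable α volume 0 t)
    (hβ : IntervalIntegrable β volume 0 t) :
    duhamel m (c₀ - d₀) (fun s => α s - β s) t = duhamel m c₀ α t - duhamel m d₀ β t := by
  rw [duhamel, duhamel, duhamel, add_sub_add_comm, ← mul_sub,
    ← intervalIntegral.integral_sub (intervalIntegrable_exp_mul hα) (intervalIntegrable_exp_mul hβ)]
  simp only [← mul_sub]

theorem duhamel_neg_add_add {γ : ℝ → ℝ} (hα : IntervalIntegrable α volume 0 t)
    (hβ : IntervalIntegrable β volume 0 t) (hγ : IntervalIntegrable γ volume 0 t) :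
    duhamel m c₀ (fun s => -α s + β s + γ s) t =
      Real.exp (-(m * t)) * c₀ - duhamel m 0 α t + duhamel m 0 β t + duhamel m 0 γ t := by
  have hα' := intervalIntegrable_exp_mul (m := m) hα
  have hβ' := intervalIntegrable_exp_mul (m := m) hβ
  simp only [duhamel, mul_add, mul_neg]
  rw [intervalIntegral.integral_add (by exact hα'.neg.add hβ') (intervalIntegrable_exp_mul hγ),
    intervalIntegral.integral_add (by exact hα'.neg) hβ', intervalIntegral.integral_neg]
  ring

theorem duhamel_eq_exp_mul (m c₀ : ℝ) (α : ℝ → ℝ) (t : ℝ) :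
    duhamel m c₀ α t =
      Real.exp (-m * t) * (c₀ + ∫ s in (0 : ℝ)..t, Real.exp (m * s) * α s) := by
  have hexp (s : ℝ) : Real.exp (-(m * (t - s))) * α s =
      Real.exp (-m * t) * (Real.exp (m * s) * α s) := by
    rw [← mul_assoc, ← Real.exp_add]
    ring_nf
  simp only [duhamel, hexp, intervalIntegral.integral_const_mul, neg_mul]
  ring

theorem absolutelyContinuousOnInterval_duhamel (m c₀ : ℝ) (hα : IntervalIntegrable α volume 0 t) :
    AbsolutelyContinuousOnInterval (duhamel m c₀ α) 0 t := by
  have hexp : AbsolutelyContinuousOnInterval (fun s => Real.exp (-m * s)) 0 t :=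
    ContDiffOn.absolutelyContinuousOnInterval (by fun_prop)
  have hconst : AbsolutelyContinuousOnInterval (fun _ => c₀) 0 t :=
    ContDiffOn.absolutelyContinuousOnInterval contDiffOn_const
  have hInt : IntervalIntegrable (fun s => Real.exp (m * s) * α s) volume 0 t :=
    hα.continuousOn_mul (by fun_prop)
  rw [funext (duhamel_eq_exp_mul m c₀ α)]
  exact hexp.fun_mul
    (hconst.fun_add (hInt.absolutelyContinuousOnInterval_intervalIntegral left_mem_uIcc))

theorem ae_hasDerivAt_duhamel (m c₀ : ℝ) (hα : IntervalIntegrable α volume 0 t) :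
    ∀ᵐ s, s ∈ uIcc 0 t →
      HasDerivAt (duhamel m c₀ α) (α s - m * duhamel m c₀ α s) s := by
  have hInt : IntervalIntegrable (fun s => Real.exp (m * s) * α s) volume 0 t :=
    hα.continuousOn_mul (by fun_prop)
  filter_upwards [hInt.ae_hasDerivAt_integral] with s hs hst
  have hexp : HasDerivAt (fun r => Real.exp (-m * r)) (Real.exp (-m * s) * (-m * 1)) s :=
    ((hasDerivAt_id s).const_mul (-m)).exp
  rw [funext (duhamel_eq_exp_mul m c₀ α)]
  refine (hexp.mul ((hs hst 0 left_mem_uIcc).const_add c₀)).congr_deriv ?_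
  have hcancel : Real.exp (-m * s) * (Real.exp (m * s) * α s) = α s := by
    rw [← mul_assoc, ← Real.exp_add]
    simp
  rw [hcancel]
  ring

theorem sq_duhamel_eq_add_integral (m c₀ : ℝ) (hα : IntervalIntegrable α volume 0 t) :
    duhamel m c₀ α t ^ 2 = c₀ ^ 2 + ∫ s in (0 : ℝ)..t,
      2 * (duhamel m c₀ α s * (α s - m * duhamel m c₀ α s)) := by
  have hac := absolutelyContinuousOnInterval_duhamel m c₀ hα
  have hftc := hac.integral_deriv_mul_eq_sub hac
  rw [duhamel_zero_right] at hftc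
  rw [sq, sq, eq_add_of_sub_eq' hftc.symm]
  congr 1
  refine intervalIntegral.integral_congr_ae ?_
  filter_upwards [ae_hasDerivAt_duhamel m c₀ hα] with s hs hst
  rw [(hs (uIoc_subset_uIcc hst)).deriv]
  ring

theorem abs_duhamel_le_exp_mul_duhamel (m l : ℝ) (ht : 0 ≤ t)
    (hβ : IntervalIntegrable β volume 0 t)
    (hαβ : ∀ᵐ s ∂(volume.restrict (Ioc 0 t)), |α s| ≤ Real.exp (l * s) * β s) :
    |duhamel m 0 α t| ≤ Real.exp (l * t) * duhamel (m + l) 0 β t := by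
  simp only [duhamel, mul_zero, zero_add, ← intervalIntegral.integral_const_mul]
  rw [← Real.norm_eq_abs]
  refine intervalIntegral.norm_integral_le_of_norm_le ht ?_
    ((intervalIntegrable_exp_mul hβ).const_mul _)
  filter_upwards [(ae_restrict_iff' measurableSet_Ioc).1 hαβ] with s hs hst
  rw [norm_mul, Real.norm_eq_abs, Real.norm_eq_abs, Real.abs_exp]
  calc Real.exp (-(m * (t - s))) * |α s|
      ≤ Real.exp (-(m * (t - s))) * (Real.exp (l * s) * β s) := by gcongr; exact hs hst
    _ = Real.exp (l * t) * (Real.exp (-((m + l) * (t - s))) * β s) := by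
      rw [← mul_assoc, ← mul_assoc, ← Real.exp_add, ← Real.exp_add]
      ring_nf

theorem integral_exp_neg_mul_sub (hm : m ≠ 0) (t : ℝ) :
    ∫ s in (0 : ℝ)..t, Real.exp (-(m * (t - s))) = (1 - Real.exp (-(m * t))) / m := by
  have hderiv : ∀ s ∈ uIcc 0 t, HasDerivAt (fun s => Real.exp (-(m * (t - s))) / m)
      (Real.exp (-(m * (t - s)))) s := fun s _ => by
    have hlin : HasDerivAt (fun s : ℝ => -(m * (t - s))) (-(m * (-1))) s :=
      (((hasDerivAt_id s).const_sub t).const_mul m).neg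
    refine (hlin.exp.div_const m).congr_deriv ?_
    field_simp
  rw [intervalIntegral.integral_eq_sub_of_hasDerivAt hderiv
    (Continuous.intervalIntegrable (by fun_prop) _ _)]
  simp only [sub_self, mul_zero, neg_zero, Real.exp_zero, sub_zero, sub_div]

theorem integral_exp_neg_mul_sub_le (hm : 0 < m) (t : ℝ) :
    ∫ s in (0 : ℝ)..t, Real.exp (-(m * (t - s))) ≤ 1 / m := by
  rw [integral_exp_neg_mul_sub hm.ne']
  gcongr
  linarith [Real.exp_pos (-(m * t))]

theorem sq_duhamel_le_integral_sq_div (hm : 0 < m) (ht : 0 ≤ t)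
    (hV : MemLp V 2 (volume.restrict (Ioc 0 t))) :
    duhamel m 0 V t ^ 2 ≤ (∫ s in Ioc 0 t, V s ^ 2) / (2 * m) := by
  have hexp : Continuous fun s => Real.exp (-(m * (t - s))) := by fun_prop
  have hexp_memLp : MemLp (fun s => Real.exp (-(m * (t - s)))) 2 (volume.restrict (Ioc 0 t)) :=
    (memLp_two_iff_integrable_sq hexp.aestronglyMeasurable).2
      ((hexp.pow 2).integrableOn_Icc.mono_set Ioc_subset_Icc_self)
  have hsq (s : ℝ) : Real.exp (-(m * (t - s))) ^ 2 = Real.exp (-((2 * m) * (t - s))) := by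
    rw [← Real.exp_nat_mul]
    ring_nf
  have hI : ∫ s in Ioc 0 t, Real.exp (-(m * (t - s))) ^ 2 ≤ 1 / (2 * m) := by
    simp only [hsq]
    rw [← intervalIntegral.integral_of_le ht]
    exact integral_exp_neg_mul_sub_le (by positivity) t
  calc duhamel m 0 V t ^ 2
      = (∫ s in Ioc 0 t, Real.exp (-(m * (t - s))) * V s) ^ 2 := by
        rw [duhamel, mul_zero, zero_add, intervalIntegral.integral_of_le ht]
    _ ≤ (∫ s in Ioc 0 t, Real.exp (-(m * (t - s))) ^ 2) * ∫ s in Ioc 0 t, V s ^ 2 :=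
        sq_integral_mul_le hexp_memLp hV
    _ ≤ 1 / (2 * m) * ∫ s in Ioc 0 t, V s ^ 2 :=
        mul_le_mul_of_nonneg_right hI (integral_nonneg fun s => sq_nonneg _)
    _ = _ := by ring

theorem sq_duhamel_const_le {k l : ℝ} (hk : 0 < k) (hl : 0 ≤ l) (ht : 0 ≤ t) :
    duhamel (k ^ 2 + l) 0 (fun _ => k) t ^ 2 ≤ 1 / (k ^ 2 + l) := by
  have hm : 0 < k ^ 2 + l := by positivity
  have hI : 0 ≤ ∫ s in (0 : ℝ)..t, Real.exp (-((k ^ 2 + l) * (t - s))) :=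
    intervalIntegral.integral_nonneg ht fun s _ => (Real.exp_pos _).le
  calc duhamel (k ^ 2 + l) 0 (fun _ => k) t ^ 2
      = (∫ s in (0 : ℝ)..t, Real.exp (-((k ^ 2 + l) * (t - s)))) ^ 2 * k ^ 2 := by
        rw [duhamel, mul_zero, zero_add, intervalIntegral.integral_mul_const, mul_pow]
    _ ≤ (1 / (k ^ 2 + l)) ^ 2 * (k ^ 2 + l) := by
        gcongr
        · exact integral_exp_neg_mul_sub_le hm t
        · linarith
    _ = 1 / (k ^ 2 + l) := by field_simp

theorem sq_duhamel_le_of_abs_le {T k l B : ℝ} (hV : MemLp V 2 (volume.restrict (Ioc 0 T)))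
    (hk : 0 < k) (hl : 0 ≤ l) (ht : t ∈ Icc 0 T)
    (hα : ∀ᵐ s ∂(volume.restrict (Ioc 0 T)), |α s| ≤ B * Real.exp (l * s) * (k + V s)) :
    duhamel (k ^ 2) 0 α t ^ 2 ≤
      (B * Real.exp (l * t)) ^ 2 * ((2 + ∫ s in Ioc 0 T, V s ^ 2) / (k ^ 2 + l)) := by
  have hm : 0 < k ^ 2 + l := by positivity
  have hsub : Ioc 0 t ⊆ Ioc 0 T := Ioc_subset_Ioc_right ht.2
  have hVt := hV.mono_measure (Measure.restrict_mono_set volume hsub)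
  have hVi : IntervalIntegrable V volume 0 t :=
    (intervalIntegrable_iff_integrableOn_Ioc_of_le ht.1).2 (hVt.integrable (by norm_num))
  have habs := abs_duhamel_le_exp_mul_duhamel (k ^ 2) l ht.1 (α := α)
    (β := fun s => B * (k + V s)) ((intervalIntegrable_const.add hVi).const_mul B) <| by
      filter_upwards [ae_mono (Measure.restrict_mono_set _ hsub) hα] with s hs
      exact hs.trans (le_of_eq (by ring))
  have hlin : duhamel (k ^ 2 + l) 0 (fun s => B * (k + V s)) t =
      B * (duhamel (k ^ 2 + l) 0 (fun _ => k) t + duhamel (k ^ 2 + l) 0 V t) := by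
    rw [duhamel_const_mul, ← duhamel_add intervalIntegrable_const hVi, add_zero]
  rw [hlin] at habs
  set x := duhamel (k ^ 2 + l) 0 (fun _ => k) t
  set y := duhamel (k ^ 2 + l) 0 V t
  have hxle : x ^ 2 ≤ 1 / (k ^ 2 + l) := sq_duhamel_const_le hk hl ht.1
  have hyle : y ^ 2 ≤ (∫ s in Ioc 0 T, V s ^ 2) / (2 * (k ^ 2 + l)) :=
    (sq_duhamel_le_integral_sq_div hm ht.1 hVt).trans <| by
      gcongr
      · exact ae_of_all _ fun s => sq_nonneg _
      · exact hV.integrable_sq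
  calc duhamel (k ^ 2) 0 α t ^ 2 ≤ (Real.exp (l * t) * (B * (x + y))) ^ 2 := sq_le_sq' (by
          linarith [neg_abs_le (duhamel (k ^ 2) 0 α t)]) ((le_abs_self _).trans habs)
    _ = (B * Real.exp (l * t)) ^ 2 * (x + y) ^ 2 := by ring
    _ ≤ (B * Real.exp (l * t)) ^ 2 * (2 * (x ^ 2 + y ^ 2)) := by gcongr; exact add_sq_le
    _ ≤ (B * Real.exp (l * t)) ^ 2 *
          (2 * (1 / (k ^ 2 + l) + (∫ s in Ioc 0 T, V s ^ 2) / (2 * (k ^ 2 + l)))) := by gcongr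
    _ = _ := by field_simp

end Duhamel

section Gronwall

theorem le_mul_exp_of_le_add_mul_integral {X : ℝ → ℝ} (hX : Continuous X) {D K T : ℝ}
    (hD : 0 ≤ D) (hK : 0 ≤ K) (hX0 : ∀ s, 0 ≤ X s)
    (h : ∀ t ∈ Icc 0 T, X t ≤ D + K * ∫ s in (0 : ℝ)..t, X s) {t : ℝ} (ht : t ∈ Icc 0 T) :
    X t ≤ D * Real.exp (K * t) := by
  set Y : ℝ → ℝ := fun t => D + K * ∫ s in (0 : ℝ)..t, X s with hY
  have hderiv (s : ℝ) : HasDerivAt Y (K * X s) s :=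
    ((hX.integral_hasStrictDerivAt 0 s).hasDerivAt.const_mul K).const_add D
  have hgronwall := norm_le_gronwallBound_of_norm_deriv_right_le (δ := D) (K := K) (ε := 0)
    (fun s _ => (hderiv s).continuousAt.continuousWithinAt)
    (fun s _ => (hderiv s).hasDerivWithinAt) (by simp [hY, abs_of_nonneg hD])
    (fun s hs => by
      rw [norm_mul, Real.norm_of_nonneg hK, Real.norm_of_nonneg (hX0 s), add_zero]
      gcongr
      exact (h s ⟨hs.1, hs.2.le⟩).trans (le_abs_self _)) t ht
  rw [gronwallBound_ε0, sub_zero] at hgronwall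
  exact (h t ht).trans ((le_abs_self _).trans hgronwall)

end Gronwall

section HilbertCoordinates

variable {ι H : Type*} [NormedAddCommGroup H] [InnerProductSpace ℝ H] (b : HilbertBasis ι ℝ H)

theorem hasSum_sq_inner (y : H) : HasSum (fun n => inner ℝ (b n) y ^ 2) (‖y‖ ^ 2) := by
  have hparseval := b.hasSum_inner_mul_inner y y
  rw [real_inner_self_eq_norm_sq] at hparseval
  exact hparseval.congr_fun fun n => by rw [real_inner_comm, sq]

theorem eq_of_inner_basis_eq {x y : H} (h : ∀ n, inner ℝ (b n) x = inner ℝ (b n) y) : x = y :=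
  b.repr.injective <| by ext n; rw [b.repr_apply_apply, b.repr_apply_apply, h]

theorem exists_inner_basis_eq {x : ι → ℝ} (hx : Summable fun n => x n ^ 2) :
    ∃ y : H, ∀ n, inner ℝ (b n) y = x n := by
  have hx_memℓp : Memℓp x 2 := memℓp_gen (by simpa using hx)
  refine ⟨b.repr.symm ⟨x, hx_memℓp⟩, fun n => ?_⟩
  rw [← b.repr_apply_apply, LinearIsometryEquiv.apply_symm_apply]

theorem norm_sq_le_tsum_of_sq_inner_le {y : H} {d : ι → ℝ} (hd : Summable d)
    (hy : ∀ n, inner ℝ (b n) y ^ 2 ≤ d n) : ‖y‖ ^ 2 ≤ ∑' n, d n :=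
  hasSum_le hy (hasSum_sq_inner b y) hd.hasSum

theorem exists_continuousMap_inner_basis_eq {X : Type*} [TopologicalSpace X] {x : ι → X → ℝ}
    (hx : ∀ n, Continuous (x n)) {d : ι → ℝ} (hd : Summable d) (hxd : ∀ n t, x n t ^ 2 ≤ d n) :
    ∃ h : C(X, H), ∀ t n, inner ℝ (b n) (h t) = x n t := by
  have hsum (t : X) : Summable fun n => x n t ^ 2 :=
    hd.of_nonneg_of_le (fun n => sq_nonneg _) fun n => hxd n t
  choose h hh using fun t => exists_inner_basis_eq b (hsum t)
  refine ⟨⟨h, continuous_iff_continuousAt.2 fun t₀ => ?_⟩, hh⟩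
  have hnorm (t : X) : ‖h t - h t₀‖ ^ 2 = ∑' n, (x n t - x n t₀) ^ 2 := by
    rw [← (hasSum_sq_inner b _).tsum_eq]
    simp only [inner_sub_right, hh]
  have htsum : Tendsto (fun t => ∑' n, (x n t - x n t₀) ^ 2) (𝓝 t₀) (𝓝 (∑' _ : ι, (0 : ℝ))) := by
    refine tendsto_tsum_of_dominated_convergence (hd.mul_left 4) (fun n => ?_) ?_
    · have hcont : Continuous fun t => (x n t - x n t₀) ^ 2 := by fun_prop
      simpa using hcont.tendsto t₀
    · refine Eventually.of_forall fun t n => ?_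
      rw [Real.norm_of_nonneg (sq_nonneg _)]
      linarith [hxd n t, hxd n t₀, sq_nonneg (x n t + x n t₀)]
  rw [ContinuousAt, tendsto_iff_norm_sub_tendsto_zero]
  have hsqrt : Tendsto (fun t => √(‖h t - h t₀‖ ^ 2)) (𝓝 t₀) (𝓝 0) := by
    simpa only [hnorm, tsum_zero, Real.sqrt_zero] using htsum.sqrt
  simpa only [Real.sqrt_sq (norm_nonneg _)] using hsqrt

variable {b} {s : Finset ι} {c : ι → ℝ} {y : H}

theorem eq_sum_smul_of_inner_basis_eq_indicator
    (h : ∀ n, inner ℝ (b n) y = (s : Set ι).indicator c n) : y = ∑ n ∈ s, c n • b n := by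
  classical
  refine eq_of_inner_basis_eq b fun n => ?_
  simp only [h, inner_sum, inner_smul_right, orthonormal_iff_ite.1 b.orthonormal n, mul_ite,
    mul_one, mul_zero, Finset.sum_ite_eq, indicator_apply, Finset.mem_coe]

theorem norm_sq_eq_sum_sq_of_inner_basis_eq_indicator
    (h : ∀ n, inner ℝ (b n) y = (s : Set ι).indicator c n) : ‖y‖ ^ 2 = ∑ n ∈ s, c n ^ 2 := by
  rw [← real_inner_self_eq_norm_sq, eq_sum_smul_of_inner_basis_eq_indicator h,
    b.orthonormal.inner_sum]
  simp only [conj_trivial, sq]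

end HilbertCoordinates

section WeightedFixedPoint

variable {X E : Type*} [TopologicalSpace X] [NormedAddCommGroup E] [NormedSpace ℝ E]
  {ω : C(X, ℝ)ˣ} {κ : NNReal}

/-- `Φ` contracts the weighted sup norm `sup ‖h‖ / ω` with constant `κ`. -/
def IsWeightedContraction (ω : C(X, ℝ)ˣ) (κ : NNReal) (Φ : C(X, E) → C(X, E)) : Prop :=
  ∀ (h k : C(X, E)) (B : ℝ), (∀ x, ‖h x - k x‖ ≤ B * ω.val x) →
    ∀ x, ‖Φ h x - Φ k x‖ ≤ κ * (B * ω.val x)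

theorem coe_inv_unit_apply (ω : C(X, ℝ)ˣ) (x : X) : ω⁻¹.val x = (ω.val x)⁻¹ :=
  eq_inv_of_mul_eq_one_left (DFunLike.congr_fun ω.inv_mul x)

theorem unit_smul_apply (ω : C(X, ℝ)ˣ) (h : C(X, E)) (x : X) : (ω • h) x = ω.val x • h x := rfl

theorem isFixedPt_conj_smul_iff {Φ : C(X, E) → C(X, E)} {h : C(X, E)} :
    Function.IsFixedPt (fun u => ω⁻¹ • Φ (ω • u)) (ω⁻¹ • h) ↔ Φ h = h := by
  rw [Function.IsFixedPt, smul_inv_smul, smul_left_cancel_iff]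

variable [CompactSpace X]

theorem continuous_unit_smul (ω : C(X, ℝ)ˣ) : Continuous fun h : C(X, E) => ω • h := by
  refine ContinuousMap.continuous_of_continuous_uncurry _ ?_
  simp only [Function.uncurry_def, unit_smul_apply]
  fun_prop

theorem IsWeightedContraction.contractingWith {Φ : C(X, E) → C(X, E)}
    (hΦ : IsWeightedContraction ω κ Φ) (hω : ∀ x, 0 < ω.val x) (hκ : κ < 1) :
    ContractingWith κ fun u => ω⁻¹ • Φ (ω • u) := by
  refine ⟨hκ, LipschitzWith.of_dist_le_mul fun u w => ?_⟩
  have hωu (x : X) : ‖(ω • u) x - (ω • w) x‖ ≤ dist u w * ω.val x := by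
    rw [unit_smul_apply, unit_smul_apply, ← smul_sub, norm_smul, Real.norm_of_nonneg (hω x).le,
      mul_comm, ← dist_eq_norm]
    exact mul_le_mul_of_nonneg_right (ContinuousMap.dist_apply_le_dist x) (hω x).le
  refine (ContinuousMap.dist_le (by positivity)).2 fun x => ?_
  rw [unit_smul_apply, unit_smul_apply, dist_eq_norm, ← smul_sub, norm_smul, coe_inv_unit_apply,
    Real.norm_of_nonneg (inv_pos.2 (hω x)).le, inv_mul_le_iff₀ (hω x)]
  exact (hΦ _ _ _ hωu x).trans (le_of_eq (by ring))

theorem IsWeightedContraction.existsUnique_fixedPoint [CompleteSpace E] {Φ : C(X, E) → C(X, E)}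
    (hΦ : IsWeightedContraction ω κ Φ) (hω : ∀ x, 0 < ω.val x) (hκ : κ < 1) :
    ∃! h, Φ h = h := by
  have hcontr := hΦ.contractingWith hω hκ
  refine ⟨ω • hcontr.fixedPoint, ?_, fun h hh => ?_⟩
  · refine (isFixedPt_conj_smul_iff (ω := ω)).1 ?_
    rw [inv_smul_smul]
    exact hcontr.fixedPoint_isFixedPt
  · rw [← hcontr.fixedPoint_unique (isFixedPt_conj_smul_iff.2 hh), smul_inv_smul]

theorem tendsto_fixedPoint_of_isWeightedContraction {σ : Type*} {l : Filter σ}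
    {Φ : σ → C(X, E) → C(X, E)} {g : σ → C(X, E)} {h : C(X, E)} (hω : ∀ x, 0 < ω.val x)
    (hκ : κ < 1) (hΦ : ∀ s, IsWeightedContraction ω κ (Φ s)) (hg : ∀ s, Φ s (g s) = g s)
    (hh : Tendsto (fun s => Φ s h) l (𝓝 h)) : Tendsto g l (𝓝 h) := by
  have hle (s : σ) : dist (ω⁻¹ • g s) (ω⁻¹ • h) ≤ dist (ω⁻¹ • h) (ω⁻¹ • Φ s h) / (1 - κ) := by
    have hfix := ((hΦ s).contractingWith hω hκ).dist_le_of_fixedPoint (ω⁻¹ • h)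
      (isFixedPt_conj_smul_iff.2 (hg s))
    rwa [dist_comm, smul_inv_smul] at hfix
  have hΦh : Tendsto (fun s => ω⁻¹ • Φ s h) l (𝓝 (ω⁻¹ • h)) :=
    ((continuous_unit_smul ω⁻¹).tendsto h).comp hh
  have hdist : Tendsto (fun s => dist (ω⁻¹ • h) (ω⁻¹ • Φ s h) / (1 - κ)) l (𝓝 0) := by
    simpa using ((tendsto_const_nhds (x := ω⁻¹ • h)).dist hΦh).div_const (1 - (κ : ℝ))
  have hconj : Tendsto (fun s => ω⁻¹ • g s) l (𝓝 (ω⁻¹ • h)) :=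
    tendsto_iff_dist_tendsto_zero.2 (squeeze_zero (fun s => dist_nonneg) hle hdist)
  simpa only [Function.comp_def, smul_inv_smul] using
    ((continuous_unit_smul ω).tendsto (ω⁻¹ • h)).comp hconj

end WeightedFixedPoint

section RadialCutoff

variable {E : Type*} [NormedAddCommGroup E] {R : ℝ}

theorem div_max_mem_Icc (hR : 0 < R) (r : ℝ) : R / max R r ∈ Icc (0 : ℝ) 1 :=
  ⟨by positivity, div_le_one_of_le₀ (le_max_left _ _) (by positivity)⟩

theorem abs_div_max_norm_sub_mul_norm_le (hR : 0 < R) (w z : E) :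
    |R / max R ‖w‖ - R / max R ‖z‖| * ‖z‖ ≤ ‖w - z‖ := by
  set p := max R ‖w‖
  set q := max R ‖z‖
  have hp0 : 0 < p := lt_max_of_lt_left hR
  have hq0 : 0 < q := lt_max_of_lt_left hR
  have hpq : |q - p| ≤ ‖w - z‖ := by
    refine (abs_max_sub_max_le_max _ _ _ _).trans ?_
    rw [sub_self, abs_zero, max_eq_right (abs_nonneg _), norm_sub_rev]
    exact abs_norm_sub_norm_le _ _
  have hdiff : R / p - R / q = R / p * ((q - p) / q) := by field_simp
  obtain ⟨hRp0, hRp⟩ := div_max_mem_Icc hR ‖w‖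
  calc |R / p - R / q| * ‖z‖ = R / p * |q - p| * (‖z‖ / q) := by
        rw [hdiff, abs_mul, abs_div (q - p), abs_of_pos hq0, abs_of_nonneg hRp0]
        ring
    _ ≤ 1 * ‖w - z‖ * 1 := by
        gcongr
        exact div_le_one_of_le₀ (le_max_right _ _) hq0.le
    _ = ‖w - z‖ := by ring

variable [NormedSpace ℝ E]

/-- The radial retraction onto the closed ball of radius `R`. -/
noncomputable def radialCutoff (R : ℝ) (w : E) : E := (R / max R ‖w‖) • w

theorem radialCutoff_of_norm_le (hR : 0 < R) {w : E} (hw : ‖w‖ ≤ R) : radialCutoff R w = w := by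
  rw [radialCutoff, max_eq_left hw, div_self hR.ne', one_smul]

theorem norm_radialCutoff_le (hR : 0 < R) (w : E) : ‖radialCutoff R w‖ ≤ R := by
  rw [radialCutoff, norm_smul, Real.norm_of_nonneg (div_max_mem_Icc hR ‖w‖).1,
    div_mul_eq_mul_div, div_le_iff₀ (by positivity)]
  exact mul_le_mul_of_nonneg_left (le_max_right _ _) hR.le

theorem continuous_radialCutoff (hR : 0 < R) : Continuous (radialCutoff R : E → E) :=
  (Continuous.div continuous_const (by fun_prop) fun _ =>
    (lt_max_of_lt_left hR).ne').smul continuous_id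

theorem norm_radialCutoff_sub_le (hR : 0 < R) (w z : E) :
    ‖radialCutoff R w - radialCutoff R z‖ ≤ 2 * ‖w - z‖ := by
  obtain ⟨hRp0, hRp⟩ := div_max_mem_Icc hR ‖w‖
  calc ‖radialCutoff R w - radialCutoff R z‖
      = ‖(R / max R ‖w‖) • (w - z) + (R / max R ‖w‖ - R / max R ‖z‖) • z‖ := by
        rw [radialCutoff, radialCutoff, smul_sub, sub_smul, sub_add_sub_cancel]
    _ ≤ R / max R ‖w‖ * ‖w - z‖ + |R / max R ‖w‖ - R / max R ‖z‖| * ‖z‖ := by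
        refine (norm_add_le _ _).trans_eq ?_
        rw [norm_smul, norm_smul, Real.norm_of_nonneg hRp0, Real.norm_eq_abs]
    _ ≤ 1 * ‖w - z‖ + ‖w - z‖ := by
        gcongr
        exact abs_div_max_norm_sub_mul_norm_le hR w z
    _ = 2 * ‖w - z‖ := by ring

/-- The path `h` extended to `ℝ` by constants and cut off at radius `R`. -/
noncomputable def cutoffPath {T : ℝ} (hT : 0 ≤ T) (R : ℝ) (h : C(Icc (0 : ℝ) T, E)) (s : ℝ) : E :=
  radialCutoff R (IccExtend hT h s)

variable {T : ℝ} {hT : 0 ≤ T} {h k : C(Icc (0 : ℝ) T, E)}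

theorem continuous_cutoffPath (hR : 0 < R) : Continuous (cutoffPath hT R h) :=
  (continuous_radialCutoff hR).comp h.continuous.Icc_extend'

theorem norm_cutoffPath_le (hR : 0 < R) (s : ℝ) : ‖cutoffPath hT R h s‖ ≤ R :=
  norm_radialCutoff_le hR _

theorem norm_cutoffPath_sub_le (hR : 0 < R) (t : Icc (0 : ℝ) T) :
    ‖cutoffPath hT R h t - cutoffPath hT R k t‖ ≤ 2 * ‖h t - k t‖ := by
  simpa only [cutoffPath, IccExtend_val] using norm_radialCutoff_sub_le hR (h t) (k t)

theorem cutoffPath_of_norm_le (hR : 0 < R) (hh : ∀ t, ‖h t‖ ≤ R) :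
    cutoffPath hT R h = IccExtend hT h :=
  funext fun _ => radialCutoff_of_norm_le hR (hh _)

end RadialCutoff

section MildEquation

variable {ι H : Type*} [NormedAddCommGroup H] [InnerProductSpace ℝ H]

/-- The conditions on the coordinates `a n s w` of a time dependent locally Lipschitz nonlinearity
under which the equation `c_n' = -k_n² c_n + a n s h`, `c_n = ⟪b n, h⟫`, is globally well posed. The
factor `θ` in the energy inequality makes it apply to the nonlinearity cut off at any radius. -/
structure IsMildNonlinearity (b : HilbertBasis ι ℝ H) (k : ι → ℝ) (T : ℝ) (V : ℝ → ℝ)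
    (a : ι → ℝ → H → ℝ) (C A : ℝ) : Prop where
  k_pos : ∀ n, 0 < k n
  summable : Summable fun n => (k n ^ 2)⁻¹
  V_memLp : MemLp V 2 (volume.restrict (Ioc 0 T))
  V_nonneg : ∀ s, 0 ≤ V s
  C_nonneg : 0 ≤ C
  A_nonneg : 0 ≤ A
  aestronglyMeasurable : ∀ n (h : ℝ → H), Continuous h →
    AEStronglyMeasurable (fun s => a n s (h s)) (volume.restrict (Ioc 0 T))
  bound_zero : ∀ᵐ s ∂(volume.restrict (Ioc 0 T)), ∀ n, |a n s 0| ≤ C * (k n + V s)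
  lipschitz : ∀ᵐ s ∂(volume.restrict (Ioc 0 T)), ∀ n w z,
    |a n s w - a n s z| ≤ C * (1 + ‖w‖ + ‖z‖) * (k n + V s) * ‖w - z‖
  energy : ∀ᵐ s ∂(volume.restrict (Ioc 0 T)), ∀ (F : Finset ι) (c : ι → ℝ), ∀ θ ∈ Icc (0 : ℝ) 1,
    ∑ n ∈ F, c n * (a n s (θ • ∑ j ∈ F, c j • b j) - k n ^ 2 * c n) ≤
      A * (∑ n ∈ F, c n ^ 2 + V s ^ 2)

/-- The `n`-th coordinate at time `t` of the mild equation with initial value `η` and nonlinearity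
evaluated along `u`. -/
noncomputable def mildCoord (b : HilbertBasis ι ℝ H) (k : ι → ℝ) (a : ι → ℝ → H → ℝ) (η : H)
    (u : ℝ → H) (n : ι) (t : ℝ) : ℝ :=
  duhamel (k n ^ 2) (inner ℝ (b n) η) (fun s => a n s (u s)) t

/-- The path `h` is the image of `u` under the mild solution map, projected onto the closed span of
the basis vectors with index in `S`. For finite `S` these are Galerkin approximations. -/
def IsMildImage {T : ℝ} (b : HilbertBasis ι ℝ H) (k : ι → ℝ) (a : ι → ℝ → H → ℝ) (η : H)
    (S : Set ι) (u : ℝ → H) (h : C(Icc (0 : ℝ) T, H)) : Prop :=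
  ∀ t n, inner ℝ (b n) (h t) = S.indicator (fun n => mildCoord b k a η u n t) n

theorem tendsto_tsum_div_add_atTop {ι : Type*} {k : ι → ℝ} (c : ℝ) (hk : ∀ n, 0 < k n)
    (hsum : Summable fun n => (k n)⁻¹) :
    Tendsto (fun l : ℝ => ∑' n, c / (k n + l)) atTop (𝓝 0) := by
  rw [← tsum_zero (β := ι)]
  refine tendsto_tsum_of_dominated_convergence (hsum.mul_left |c|) (fun n => ?_) ?_
  · exact Tendsto.const_div_atTop (tendsto_atTop_add_const_left _ _ tendsto_id) _
  · filter_upwards [eventually_ge_atTop (0 : ℝ)] with l hl n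
    have := hk n
    rw [norm_div, Real.norm_eq_abs, Real.norm_of_nonneg (by positivity), ← div_eq_mul_inv]
    gcongr
    linarith

namespace IsMildNonlinearity

variable {b : HilbertBasis ι ℝ H} {k : ι → ℝ} {T : ℝ} {V : ℝ → ℝ} {a : ι → ℝ → H → ℝ} {C A : ℝ}
  {η : H} {u w : ℝ → H} {R : ℝ}

theorem abs_le (ha : IsMildNonlinearity b k T V a C A) (huR : ∀ s, ‖u s‖ ≤ R) :
    ∀ᵐ s ∂(volume.restrict (Ioc 0 T)), ∀ n,
      |a n s (u s)| ≤ C * (1 + (1 + R) * R) * (k n + V s) := by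
  have hR : 0 ≤ R := (norm_nonneg _).trans (huR 0)
  have hC := ha.C_nonneg
  filter_upwards [ha.bound_zero, ha.lipschitz] with s hzero hlip n
  have hkV : 0 ≤ k n + V s := add_nonneg (ha.k_pos n).le (ha.V_nonneg s)
  calc |a n s (u s)| ≤ |a n s 0| + |a n s (u s) - a n s 0| := by
        linarith [abs_sub_abs_le_abs_sub (a n s (u s)) (a n s 0)]
    _ ≤ C * (k n + V s) + C * (1 + ‖u s‖) * (k n + V s) * ‖u s‖ := by
        have hlip0 := hlip n (u s) 0
        rw [norm_zero, add_zero, sub_zero] at hlip0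
        exact add_le_add (hzero n) hlip0
    _ ≤ C * (k n + V s) + C * (1 + R) * (k n + V s) * R := by
        gcongr
        exacts [huR s, huR s]
    _ = C * (1 + (1 + R) * R) * (k n + V s) := by ring

theorem intervalIntegrable (ha : IsMildNonlinearity b k T V a C A) (hu : Continuous u)
    (huR : ∀ s, ‖u s‖ ≤ R) (n : ι) {t : ℝ} (ht : t ∈ Icc 0 T) :
    IntervalIntegrable (fun s => a n s (u s)) volume 0 t := by
  rw [intervalIntegrable_iff_integrableOn_Ioc_of_le ht.1]
  have hbound : Integrable (fun s => C * (1 + (1 + R) * R) * (k n + V s))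
      (volume.restrict (Ioc 0 T)) :=
    ((integrable_const _).add (ha.V_memLp.integrable (by norm_num))).const_mul _
  refine IntegrableOn.mono_set (hbound.mono' (ha.aestronglyMeasurable n u hu) ?_)
    (Ioc_subset_Ioc_right ht.2)
  filter_upwards [ha.abs_le huR] with s hs using hs n

theorem continuousOn_mildCoord (ha : IsMildNonlinearity b k T V a C A) (hu : Continuous u)
    (huR : ∀ s, ‖u s‖ ≤ R) (n : ι) {t : ℝ} (ht : t ∈ Icc 0 T) :
    ContinuousOn (mildCoord b k a η u n) (uIcc 0 t) :=
  (absolutelyContinuousOnInterval_duhamel _ _ (ha.intervalIntegrable hu huR n ht)).continuousOn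

theorem exists_summable_sq_mildCoord_le (ha : IsMildNonlinearity b k T V a C A) (η : H)
    (hu : Continuous u) (huR : ∀ s, ‖u s‖ ≤ R) :
    ∃ d : ι → ℝ, Summable d ∧ ∀ n, ∀ t ∈ Icc 0 T, mildCoord b k a η u n t ^ 2 ≤ d n := by
  set W := ∫ s in Ioc 0 T, V s ^ 2
  set B := C * (1 + (1 + R) * R)
  refine ⟨fun n => 2 * (inner ℝ (b n) η ^ 2 + B ^ 2 * (2 + W) * (k n ^ 2)⁻¹),
    ((hasSum_sq_inner b η).summable.add (ha.summable.mul_left _)).mul_left 2, fun n t ht => ?_⟩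
  set x := duhamel (k n ^ 2) (inner ℝ (b n) η) (fun _ => 0) t with hx
  set y := duhamel (k n ^ 2) 0 (fun s => a n s (u s)) t with hy
  have hsplit : mildCoord b k a η u n t = x + y := by
    rw [hx, hy, ← duhamel_add intervalIntegrable_const (ha.intervalIntegrable hu huR n ht)]
    simp only [mildCoord, add_zero, zero_add]
  have hxle : x ^ 2 ≤ inner ℝ (b n) η ^ 2 := by
    simp only [hx, duhamel, mul_zero, intervalIntegral.integral_zero, add_zero, mul_pow]
    refine mul_le_of_le_one_left (sq_nonneg _) (pow_le_one₀ (Real.exp_pos _).le ?_)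
    exact Real.exp_le_one_iff.2 (neg_nonpos.2 (mul_nonneg (sq_nonneg _) ht.1))
  have hyle : y ^ 2 ≤ B ^ 2 * (2 + W) * (k n ^ 2)⁻¹ := by
    refine (sq_duhamel_le_of_abs_le (B := B) ha.V_memLp (ha.k_pos n) le_rfl ht ?_).trans_eq ?_
    · filter_upwards [ha.abs_le huR] with s hs
      simpa using hs n
    · simp only [zero_mul, Real.exp_zero, mul_one, add_zero, div_eq_mul_inv, W]
      ring
  calc mildCoord b k a η u n t ^ 2 = (x + y) ^ 2 := by rw [hsplit]
    _ ≤ 2 * (x ^ 2 + y ^ 2) := add_sq_le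
    _ ≤ 2 * (inner ℝ (b n) η ^ 2 + B ^ 2 * (2 + W) * (k n ^ 2)⁻¹) := by gcongr

theorem exists_isMildImage (ha : IsMildNonlinearity b k T V a C A) (hT : 0 ≤ T) (η : H)
    (hu : Continuous u) (huR : ∀ s, ‖u s‖ ≤ R) (S : Set ι) :
    ∃ h : C(Icc (0 : ℝ) T, H), IsMildImage b k a η S u h := by
  obtain ⟨d, hd, hle⟩ := ha.exists_summable_sq_mildCoord_le η hu huR
  refine exists_continuousMap_inner_basis_eq b
    (x := fun n (t : Icc (0 : ℝ) T) => S.indicator (fun n => mildCoord b k a η u n t) n)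
    (fun n => ?_) hd fun n t => ?_
  · have hcont := ha.continuousOn_mildCoord hu huR n (η := η) (right_mem_Icc.2 hT)
    rw [uIcc_of_le hT] at hcont
    by_cases hn : n ∈ S
    · simp only [indicator_of_mem hn]
      exact hcont.domRestrict
    · simpa only [indicator_of_notMem hn] using continuous_const
  · by_cases hn : n ∈ S
    · simpa only [indicator_of_mem hn] using hle n t t.2
    · rw [indicator_of_notMem hn, zero_pow two_ne_zero]
      exact (sq_nonneg _).trans (hle n t t.2)

theorem sq_mildCoord_sub_le (ha : IsMildNonlinearity b k T V a C A) (hu : Continuous u)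
    (hw : Continuous w) (huR : ∀ s, ‖u s‖ ≤ R) (hwR : ∀ s, ‖w s‖ ≤ R) {l B : ℝ} (hl : 0 ≤ l)
    (huw : ∀ s ∈ Icc 0 T, ‖u s - w s‖ ≤ B * Real.exp (l * s)) (n : ι) {t : ℝ} (ht : t ∈ Icc 0 T) :
    (mildCoord b k a η u n t - mildCoord b k a η w n t) ^ 2 ≤
      (C * (1 + R + R) * B * Real.exp (l * t)) ^ 2 *
        ((2 + ∫ s in Ioc 0 T, V s ^ 2) / (k n ^ 2 + l)) := by
  rw [mildCoord, mildCoord, ← duhamel_sub (ha.intervalIntegrable hu huR n ht)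
    (ha.intervalIntegrable hw hwR n ht), sub_self]
  refine sq_duhamel_le_of_abs_le ha.V_memLp (ha.k_pos n) hl ht ?_
  filter_upwards [ha.lipschitz, ae_restrict_mem measurableSet_Ioc] with s hs hsT
  have hR : 0 ≤ R := (norm_nonneg _).trans (huR 0)
  have hC := ha.C_nonneg
  have hkV : 0 ≤ k n + V s := add_nonneg (ha.k_pos n).le (ha.V_nonneg s)
  calc |a n s (u s) - a n s (w s)|
      ≤ C * (1 + ‖u s‖ + ‖w s‖) * (k n + V s) * ‖u s - w s‖ := hs n (u s) (w s)
    _ ≤ C * (1 + R + R) * (k n + V s) * (B * Real.exp (l * s)) := by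
        gcongr
        exacts [huR s, hwR s, huw s ⟨hsT.1.le, hsT.2⟩]
    _ = C * (1 + R + R) * B * Real.exp (l * s) * (k n + V s) := by ring

theorem norm_sub_sq_le_of_isMildImage (ha : IsMildNonlinearity b k T V a C A) (hu : Continuous u)
    (hw : Continuous w) (huR : ∀ s, ‖u s‖ ≤ R) (hwR : ∀ s, ‖w s‖ ≤ R) {l B : ℝ} (hl : 0 ≤ l)
    (huw : ∀ s ∈ Icc 0 T, ‖u s - w s‖ ≤ B * Real.exp (l * s)) {S : Set ι}
    {y z : C(Icc (0 : ℝ) T, H)} (hy : IsMildImage b k a η S u y)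
    (hz : IsMildImage b k a η S w z) (t : Icc (0 : ℝ) T) :
    ‖y t - z t‖ ^ 2 ≤ (C * (1 + R + R) * B * Real.exp (l * t)) ^ 2 *
      ∑' n, (2 + ∫ s in Ioc 0 T, V s ^ 2) / (k n ^ 2 + l) := by
  set W := ∫ s in Ioc 0 T, V s ^ 2
  have : 0 ≤ W := integral_nonneg fun s => sq_nonneg _
  have hk (n : ι) : 0 < k n ^ 2 := pow_pos (ha.k_pos n) 2
  have hsum : Summable fun n => (2 + W) / (k n ^ 2 + l) := by
    refine (ha.summable.mul_left (2 + W)).of_nonneg_of_le (fun n => ?_) fun n => ?_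
    · have := hk n
      positivity
    · have := hk n
      rw [← div_eq_mul_inv]
      gcongr
      linarith
  rw [← tsum_mul_left]
  refine norm_sq_le_tsum_of_sq_inner_le b (hsum.mul_left _) fun n => ?_
  rw [inner_sub_right, hy, hz]
  by_cases hn : n ∈ S
  · rw [indicator_of_mem hn, indicator_of_mem hn]
    exact ha.sq_mildCoord_sub_le hu hw huR hwR hl huw n t.2
  · have := hk n
    rw [indicator_of_notMem hn, indicator_of_notMem hn, sub_zero, zero_pow two_ne_zero]
    positivity

theorem exists_weight (ha : IsMildNonlinearity b k T V a C A) (R : ℝ) :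
    ∃ l : ℝ, ∀ (η : H) (S : Set ι) (u w : ℝ → H), Continuous u → Continuous w →
      (∀ s, ‖u s‖ ≤ R) → (∀ s, ‖w s‖ ≤ R) → ∀ B, 0 ≤ B →
      (∀ s ∈ Icc 0 T, ‖u s - w s‖ ≤ B * Real.exp (l * s)) →
      ∀ y z : C(Icc (0 : ℝ) T, H), IsMildImage b k a η S u y → IsMildImage b k a η S w z →
        ∀ t : Icc (0 : ℝ) T, ‖y t - z t‖ ≤ 1 / 4 * (B * Real.exp (l * t)) := by
  set K := C * (1 + R + R)
  have hlim : Tendsto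
      (fun l => K ^ 2 * ∑' n, (2 + ∫ s in Ioc 0 T, V s ^ 2) / (k n ^ 2 + l)) atTop (𝓝 0) := by
    simpa using (tendsto_tsum_div_add_atTop _ (fun n => pow_pos (ha.k_pos n) 2)
      ha.summable).const_mul (K ^ 2)
  obtain ⟨l, hle, hl⟩ := ((hlim.eventually (ge_mem_nhds (show (0 : ℝ) < (1 / 4) ^ 2 by
    norm_num))).and (eventually_ge_atTop 0)).exists
  refine ⟨l, fun η S u w hu hw huR hwR B hB huw y z hy hz t => ?_⟩
  refine le_of_sq_le_sq ?_ (by positivity)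
  calc ‖y t - z t‖ ^ 2
      ≤ (K * B * Real.exp (l * t)) ^ 2 *
          ∑' n, (2 + ∫ s in Ioc 0 T, V s ^ 2) / (k n ^ 2 + l) :=
        ha.norm_sub_sq_le_of_isMildImage hu hw huR hwR hl huw hy hz t
    _ = (B * Real.exp (l * t)) ^ 2 *
          (K ^ 2 * ∑' n, (2 + ∫ s in Ioc 0 T, V s ^ 2) / (k n ^ 2 + l)) := by ring
    _ ≤ (B * Real.exp (l * t)) ^ 2 * (1 / 4) ^ 2 := by gcongr
    _ = (1 / 4 * (B * Real.exp (l * t))) ^ 2 := by ring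

end IsMildNonlinearity

end MildEquation

section WellPosedness

namespace IsMildNonlinearity

variable {ι H : Type*} [NormedAddCommGroup H] [InnerProductSpace ℝ H] {b : HilbertBasis ι ℝ H}
  {k : ι → ℝ} {T : ℝ} {V : ℝ → ℝ} {a : ι → ℝ → H → ℝ} {C A R : ℝ} {η : H} {u : ℝ → H}
  {F : Finset ι} {hT : 0 ≤ T} {h : C(Icc (0 : ℝ) T, H)}

theorem exists_solutionMap (ha : IsMildNonlinearity b k T V a C A) (hT : 0 ≤ T) (η : H)
    (hR : 0 < R) :
    ∃ (ω : C(Icc (0 : ℝ) T, ℝ)ˣ) (Φ : Set ι → C(Icc (0 : ℝ) T, H) → C(Icc (0 : ℝ) T, H)),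
      (∀ t, 0 < ω.val t) ∧ (∀ S h, IsMildImage b k a η S (cutoffPath hT R h) (Φ S h)) ∧
        ∀ S, IsWeightedContraction ω (1 / 2) (Φ S) := by
  obtain ⟨l, hl⟩ := ha.exists_weight R
  choose Φ hΦ using fun S (h : C(Icc (0 : ℝ) T, H)) => ha.exists_isMildImage hT η
    (continuous_cutoffPath (hT := hT) (h := h) hR) (norm_cutoffPath_le hR) S
  let ω : C(Icc (0 : ℝ) T, ℝ)ˣ :=
    ⟨⟨fun t => Real.exp (l * t), by fun_prop⟩, ⟨fun t => Real.exp (-(l * t)), by fun_prop⟩,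
      by ext t; simp [← Real.exp_add], by ext t; simp [← Real.exp_add]⟩
  refine ⟨ω, Φ, fun t => Real.exp_pos _, hΦ, fun S h h' B hB t => ?_⟩
  have hB0 : 0 ≤ B := nonneg_of_mul_nonneg_left ((norm_nonneg _).trans (hB t)) (Real.exp_pos _)
  have hcut (s : ℝ) (hs : s ∈ Icc 0 T) :
      ‖cutoffPath hT R h s - cutoffPath hT R h' s‖ ≤ 2 * B * Real.exp (l * s) :=
    (norm_cutoffPath_sub_le hR ⟨s, hs⟩).trans <|
      (mul_le_mul_of_nonneg_left (hB ⟨s, hs⟩) zero_le_two).trans_eq (mul_assoc _ _ _).symm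
  calc ‖Φ S h t - Φ S h' t‖ ≤ 1 / 4 * (2 * B * Real.exp (l * t)) :=
        hl η S _ _ (continuous_cutoffPath hR) (continuous_cutoffPath hR) (norm_cutoffPath_le hR)
          (norm_cutoffPath_le hR) (2 * B) (by positivity) hcut _ _ (hΦ S h) (hΦ S h') t
    _ = (1 / 2 : NNReal) * (B * Real.exp (l * t)) := by push_cast; ring

theorem intervalIntegrable_mildCoord_mul (ha : IsMildNonlinearity b k T V a C A)
    (hu : Continuous u) (huR : ∀ s, ‖u s‖ ≤ R) (n : ι) {t : ℝ} (ht : t ∈ Icc 0 T) :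
    IntervalIntegrable (fun s => 2 * (mildCoord b k a η u n s *
      (a n s (u s) - k n ^ 2 * mildCoord b k a η u n s))) volume 0 t := by
  have hcont := ha.continuousOn_mildCoord (η := η) hu huR n ht
  exact (((ha.intervalIntegrable hu huR n ht).sub
    (hcont.intervalIntegrable.const_mul _)).continuousOn_mul hcont).const_mul 2

theorem norm_sq_eq_add_integral (ha : IsMildNonlinearity b k T V a C A) (hu : Continuous u)
    (huR : ∀ s, ‖u s‖ ≤ R) (hh : IsMildImage b k a η F u h) (t : Icc (0 : ℝ) T) :
    ‖h t‖ ^ 2 = ∑ n ∈ F, inner ℝ (b n) η ^ 2 + ∫ s in (0 : ℝ)..t, ∑ n ∈ F,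
      2 * (mildCoord b k a η u n s * (a n s (u s) - k n ^ 2 * mildCoord b k a η u n s)) := by
  rw [norm_sq_eq_sum_sq_of_inner_basis_eq_indicator (hh t), intervalIntegral.integral_finsetSum
    fun n _ => ha.intervalIntegrable_mildCoord_mul hu huR n t.2, ← Finset.sum_add_distrib]
  exact Finset.sum_congr rfl fun n _ =>
    sq_duhamel_eq_add_integral _ _ (ha.intervalIntegrable hu huR n t.2)

theorem energy_galerkin_le (ha : IsMildNonlinearity b k T V a C A) (hR : 0 < R)
    (hh : IsMildImage b k a η F (cutoffPath hT R h) h) :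
    ∀ᵐ s ∂(volume.restrict (Ioc 0 T)),
      ∑ n ∈ F, 2 * (mildCoord b k a η (cutoffPath hT R h) n s *
        (a n s (cutoffPath hT R h s) - k n ^ 2 * mildCoord b k a η (cutoffPath hT R h) n s)) ≤
      2 * A * (‖IccExtend hT h s‖ ^ 2 + V s ^ 2) := by
  filter_upwards [ha.energy, ae_restrict_mem measurableSet_Ioc] with s henergy hs
  have hcoord := hh ⟨s, hs.1.le, hs.2⟩
  rw [← IccExtend_of_mem hT h ⟨hs.1.le, hs.2⟩] at hcoord
  have hle := henergy F (fun n => mildCoord b k a η (cutoffPath hT R h) n s) _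
    (div_max_mem_Icc hR ‖IccExtend hT h s‖)
  rw [← eq_sum_smul_of_inner_basis_eq_indicator hcoord,
    ← norm_sq_eq_sum_sq_of_inner_basis_eq_indicator hcoord] at hle
  rw [← Finset.mul_sum, mul_assoc]
  exact mul_le_mul_of_nonneg_left hle zero_le_two

theorem norm_sq_le_add_mul_integral (ha : IsMildNonlinearity b k T V a C A) (hR : 0 < R)
    (hh : IsMildImage b k a η F (cutoffPath hT R h) h) (t : Icc (0 : ℝ) T) :
    ‖h t‖ ^ 2 ≤ ‖η‖ ^ 2 + 2 * A * (∫ s in Ioc 0 T, V s ^ 2) +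
      2 * A * ∫ s in (0 : ℝ)..t, ‖IccExtend hT h s‖ ^ 2 := by
  have hA := ha.A_nonneg
  have ht0 : (0 : ℝ) ≤ t := t.2.1
  have hsub : Ioc 0 (t : ℝ) ⊆ Ioc 0 T := Ioc_subset_Ioc_right t.2.2
  have hV : IntegrableOn (fun s => V s ^ 2) (Ioc 0 T) := ha.V_memLp.integrable_sq
  have hVt : IntervalIntegrable (fun s => V s ^ 2) volume 0 t :=
    (intervalIntegrable_iff_integrableOn_Ioc_of_le ht0).2 (hV.mono_set hsub)
  have hht : IntervalIntegrable (fun s => ‖IccExtend hT h s‖ ^ 2) volume 0 t :=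
    (h.continuous.Icc_extend'.norm.pow 2).intervalIntegrable 0 t
  have hηle : ∑ n ∈ F, inner ℝ (b n) η ^ 2 ≤ ‖η‖ ^ 2 :=
    sum_le_hasSum _ (fun n _ => sq_nonneg _) (hasSum_sq_inner b η)
  have hVle : ∫ s in (0 : ℝ)..t, V s ^ 2 ≤ ∫ s in Ioc 0 T, V s ^ 2 := by
    rw [intervalIntegral.integral_of_le ht0]
    exact setIntegral_mono_set hV (ae_of_all _ fun s => sq_nonneg _) hsub.eventuallyLE
  rw [ha.norm_sq_eq_add_integral (continuous_cutoffPath hR) (norm_cutoffPath_le hR) hh t]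
  calc _ ≤ ‖η‖ ^ 2 + ∫ s in (0 : ℝ)..t, 2 * A * (‖IccExtend hT h s‖ ^ 2 + V s ^ 2) := by
        refine add_le_add hηle (intervalIntegral.integral_mono_ae_restrict ht0 ?_
          ((hht.add hVt).const_mul _) ?_)
        · simpa only [Finset.sum_fn] using IntervalIntegrable.sum _ fun n _ =>
            ha.intervalIntegrable_mildCoord_mul (continuous_cutoffPath hR)
              (norm_cutoffPath_le hR) n t.2
        · rw [Measure.restrict_congr_set Ioc_ae_eq_Icc.symm]
          exact ae_mono (Measure.restrict_mono_set _ hsub) (ha.energy_galerkin_le hR hh)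
    _ = ‖η‖ ^ 2 + 2 * A * (∫ s in (0 : ℝ)..t, V s ^ 2) +
          2 * A * ∫ s in (0 : ℝ)..t, ‖IccExtend hT h s‖ ^ 2 := by
        rw [intervalIntegral.integral_const_mul, intervalIntegral.integral_add hht hVt]
        ring
    _ ≤ _ := by gcongr

theorem norm_sq_le_of_galerkin (ha : IsMildNonlinearity b k T V a C A) (hR : 0 < R)
    (hh : IsMildImage b k a η F (cutoffPath hT R h) h) (t : Icc (0 : ℝ) T) :
    ‖h t‖ ^ 2 ≤ (‖η‖ ^ 2 + 2 * A * ∫ s in Ioc 0 T, V s ^ 2) * Real.exp (2 * A * T) := by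
  have hA := ha.A_nonneg
  have hD : 0 ≤ ‖η‖ ^ 2 + 2 * A * ∫ s in Ioc 0 T, V s ^ 2 :=
    add_nonneg (sq_nonneg _) (mul_nonneg (by positivity) (integral_nonneg fun s => sq_nonneg _))
  have hgronwall := le_mul_exp_of_le_add_mul_integral (X := fun s => ‖IccExtend hT h s‖ ^ 2)
    (h.continuous.Icc_extend'.norm.pow 2) hD (mul_nonneg zero_le_two hA) (fun s => sq_nonneg _)
    (fun s hs => by
      simpa only [IccExtend_of_mem hT h hs] using ha.norm_sq_le_add_mul_integral hR hh ⟨s, hs⟩)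
    t.2
  simp only [IccExtend_val] at hgronwall
  exact hgronwall.trans (by gcongr; exact t.2.2)

theorem tendsto_of_isMildImage (ha : IsMildNonlinearity b k T V a C A) (hu : Continuous u)
    (huR : ∀ s, ‖u s‖ ≤ R) {y : Finset ι → C(Icc (0 : ℝ) T, H)}
    (hy : ∀ F : Finset ι, IsMildImage b k a η F u (y F)) (hh : IsMildImage b k a η univ u h) :
    Tendsto y atTop (𝓝 h) := by
  obtain ⟨d, hd, hle⟩ := ha.exists_summable_sq_mildCoord_le η hu huR
  have htail (F : Finset ι) (t : Icc (0 : ℝ) T) :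
      ‖y F t - h t‖ ^ 2 ≤ ∑' n, ((F : Set ι)ᶜ).indicator d n := by
    refine norm_sq_le_tsum_of_sq_inner_le b (hd.indicator _) fun n => ?_
    rw [inner_sub_right, hy, hh, indicator_univ]
    by_cases hn : n ∈ (F : Set ι)
    · rw [indicator_of_mem hn, indicator_of_notMem (notMem_compl_iff.2 hn), sub_self,
        zero_pow two_ne_zero]
    · rw [indicator_of_notMem hn, indicator_of_mem (mem_compl hn), zero_sub, neg_sq]
      exact hle n t t.2
  have hlim : Tendsto (fun F : Finset ι => √(∑' n, ((F : Set ι)ᶜ).indicator d n)) atTop (𝓝 0) := by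
    have hcompl := (tendsto_tsum_compl_atTop_zero d).sqrt
    rw [Real.sqrt_zero] at hcompl
    exact hcompl.congr fun F => congrArg Real.sqrt (tsum_subtype _ d)
  rw [tendsto_iff_dist_tendsto_zero]
  refine squeeze_zero (fun F => dist_nonneg) (fun F => ?_) hlim
  rw [ContinuousMap.dist_le (Real.sqrt_nonneg _)]
  intro t
  rw [dist_eq_norm]
  exact Real.le_sqrt_of_sq_le (htail F t)

variable [CompleteSpace H]

theorem exists_mild (ha : IsMildNonlinearity b k T V a C A) (hT : 0 ≤ T) (η : H) :
    ∃ h : C(Icc (0 : ℝ) T, H), ∀ t n,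
      inner ℝ (b n) (h t) = mildCoord b k a η (IccExtend hT h) n t := by
  set D := (‖η‖ ^ 2 + 2 * A * ∫ s in Ioc 0 T, V s ^ 2) * Real.exp (2 * A * T)
  have hR : 0 < √D + 1 := by positivity
  obtain ⟨ω, Φ, hω, hΦ, hcontr⟩ := ha.exists_solutionMap hT η hR
  choose g hg using fun S => ((hcontr S).existsUnique_fixedPoint hω (by norm_num)).exists
  have hfix (S : Set ι) : IsMildImage b k a η S (cutoffPath hT (√D + 1) (g S)) (g S) := by
    simpa only [hg S] using hΦ S (g S)
  have hlim : Tendsto (fun F : Finset ι => g F) atTop (𝓝 (g univ)) :=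
    tendsto_fixedPoint_of_isWeightedContraction hω (by norm_num) (fun F : Finset ι => hcontr F)
      (fun F => hg F) (ha.tendsto_of_isMildImage (continuous_cutoffPath hR)
        (norm_cutoffPath_le hR) (fun F => hΦ F (g univ)) (hfix univ))
  have hbound (t : Icc (0 : ℝ) T) : ‖g univ t‖ ≤ √D + 1 := by
    have hlimt : Tendsto (fun F : Finset ι => ‖g F t‖) atTop (𝓝 ‖g univ t‖) :=
      (((continuous_eval_const t).tendsto _).comp hlim).norm
    refine (le_of_tendsto' hlimt fun F => ?_).trans (le_add_of_nonneg_right zero_le_one)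
    exact Real.le_sqrt_of_sq_le (ha.norm_sq_le_of_galerkin hR (hfix F) t)
  refine ⟨g univ, fun t n => ?_⟩
  rw [hfix univ t n, indicator_univ, cutoffPath_of_norm_le hR hbound]

theorem eq_of_mild (ha : IsMildNonlinearity b k T V a C A) {h h' : C(Icc (0 : ℝ) T, H)}
    (hh : ∀ t n, inner ℝ (b n) (h t) = mildCoord b k a η (IccExtend hT h) n t)
    (hh' : ∀ t n, inner ℝ (b n) (h' t) = mildCoord b k a η (IccExtend hT h') n t) : h = h' := by
  have hR : 0 < max ‖h‖ ‖h'‖ + 1 := by positivity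
  obtain ⟨ω, Φ, hω, hΦ, hcontr⟩ := ha.exists_solutionMap hT η hR
  have hfix (z : C(Icc (0 : ℝ) T, H)) (hz : ‖z‖ ≤ max ‖h‖ ‖h'‖)
      (hmild : ∀ t n, inner ℝ (b n) (z t) = mildCoord b k a η (IccExtend hT z) n t) :
      Φ univ z = z := by
    ext t
    refine eq_of_inner_basis_eq b fun n => ?_
    rw [hΦ, indicator_univ, cutoffPath_of_norm_le hR fun t => (z.norm_coe_le_norm t).trans
      (hz.trans (le_add_of_nonneg_right zero_le_one)), hmild]
  exact ((hcontr univ).existsUnique_fixedPoint hω (by norm_num)).unique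
    (hfix h (le_max_left _ _) hh) (hfix h' (le_max_right _ _) hh')

theorem existsUnique_mild (ha : IsMildNonlinearity b k T V a C A) (hT : 0 ≤ T) (η : H) :
    ∃! h : C(Icc (0 : ℝ) T, H), ∀ t n,
      inner ℝ (b n) (h t) = mildCoord b k a η (IccExtend hT h) n t :=
  existsUnique_of_exists_of_unique (ha.exists_mild hT η) fun _ _ hh hh' => ha.eq_of_mild hh hh'

end IsMildNonlinearity

end WellPosedness

section JointlyMeasurableVersion

variable {α E : Type*} {m : MeasurableSpace α} {μ : Measure α} {p : ENNReal} [Fact (1 ≤ p)]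
  [NormedAddCommGroup E]

theorem ae_tendsto_of_summable_norm_sub {w : ℕ → Lp E p μ} {z : Lp E p μ}
    (h : Summable fun n => ‖w n - z‖) : ∀ᵐ y ∂μ, Tendsto (fun n => w n y) atTop (𝓝 (z y)) := by
  have hsum : ∑' n, eLpNorm (w n - z : Lp E p μ) p μ ≠ ⊤ := by
    simpa only [Lp.enorm_def] using tsum_enorm_ne_top_iff_summable_norm.2 h
  filter_upwards [summable_norm_of_tsum_eLpNorm_ne_top Fact.out
    (fun n => Lp.aestronglyMeasurable (w n - z)) hsum, ae_all_iff.2 fun n => Lp.coeFn_sub (w n) z]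
    with y hy hsub
  rw [tendsto_iff_norm_sub_tendsto_zero]
  simpa only [hsub, Pi.sub_apply] using hy.tendsto_atTop_zero

theorem exists_measurable_version [CompleteSpace E] [SecondCountableTopology E]
    [MeasurableSpace E] [BorelSpace E] {X : Type*} [TopologicalSpace X]
    [TopologicalSpace.SeparableSpace X] [Nonempty X] [MeasurableSpace X] [OpensMeasurableSpace X]
    {u : X → Lp E p μ} (hu : Continuous u) :
    ∃ φ : X × α → E, Measurable φ ∧ ∀ s, u s =ᵐ[μ] fun y => φ (s, y) := by
  classical
  set d : ℕ → Lp E p μ := fun i => u (TopologicalSpace.denseSeq X i)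
  have hdense (n : ℕ) (s : X) : ∃ i, dist (u s) (d i) < (1 / 2) ^ n :=
    (TopologicalSpace.denseRange_denseSeq X).exists_mem_open
      (isOpen_lt (continuous_const.dist hu) continuous_const) ⟨s, by simp⟩
  set j : ℕ → X → ℕ := fun n s => Nat.find (hdense n s)
  have hj (n : ℕ) : Measurable (j n) := measurable_find (hdense n) fun i =>
    (isOpen_lt (hu.dist continuous_const) continuous_const).measurableSet
  have hd : Measurable fun q : ℕ × α => d q.1 q.2 :=
    measurable_from_prod_countable_right fun i => (Lp.stronglyMeasurable (d i)).measurable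
  have happrox (n : ℕ) : StronglyMeasurable fun q : X × α => d (j n q.1) q.2 :=
    (hd.comp (((hj n).comp measurable_fst).prodMk measurable_snd)).stronglyMeasurable
  refine ⟨_, (StronglyMeasurable.limUnder (l := atTop) happrox).measurable, fun s => ?_⟩
  have hsum : Summable fun n => ‖d (j n s) - u s‖ := by
    refine summable_geometric_two.of_nonneg_of_le (fun n => norm_nonneg _) fun n => ?_
    rw [← dist_eq_norm, dist_comm]
    exact (Nat.find_spec (hdense n s)).le
  filter_upwards [ae_tendsto_of_summable_norm_sub hsum] with y hy using hy.limUnder_eq.symm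

end JointlyMeasurableVersion

section SineCompleteness

open Polynomial in
theorem integral_mul_comp_eq_zero_of_polynomial {α : Type*} [MeasurableSpace α] {μ : Measure α}
    {F θ : α → ℝ} {a b : ℝ} (hF : Integrable F μ) (hθ : AEStronglyMeasurable θ μ)
    (hθab : ∀ x, θ x ∈ Icc a b) (hpoly : ∀ p : ℝ[X], ∫ x, F x * p.eval (θ x) ∂μ = 0)
    {ψ : ℝ → ℝ} (hψ : Continuous ψ) : ∫ x, F x * ψ (θ x) ∂μ = 0 := by
  have hInt {q : ℝ → ℝ} (hq : Continuous q) : Integrable (fun x => F x * q (θ x)) μ := by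
    obtain ⟨B, hB⟩ := isCompact_Icc.exists_bound_of_continuousOn (s := Icc a b) hq.continuousOn
    exact hF.mul_bdd (hq.comp_aestronglyMeasurable hθ) (ae_of_all _ fun x => hB _ (hθab x))
  have hbound (ε : ℝ) (hε : 0 < ε) : ‖∫ x, F x * ψ (θ x) ∂μ‖ ≤ ε * ∫ x, |F x| ∂μ := by
    obtain ⟨p, hp⟩ := exists_polynomial_near_of_continuousOn a b ψ hψ.continuousOn ε hε
    calc ‖∫ x, F x * ψ (θ x) ∂μ‖ = ‖∫ x, (F x * ψ (θ x) - F x * p.eval (θ x)) ∂μ‖ := by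
          rw [integral_sub (hInt hψ) (hInt p.continuous), hpoly, sub_zero]
      _ ≤ ∫ x, ε * |F x| ∂μ := by
          refine norm_integral_le_of_norm_le (hF.abs.const_mul ε) (ae_of_all _ fun x => ?_)
          rw [← mul_sub, norm_mul, Real.norm_eq_abs, Real.norm_eq_abs, abs_sub_comm, mul_comm]
          exact mul_le_mul_of_nonneg_right (hp _ (hθab x)).le (abs_nonneg _)
      _ = ε * ∫ x, |F x| ∂μ := integral_const_mul _ _
  have hlim : Tendsto (fun ε : ℝ => ε * ∫ x, |F x| ∂μ) (𝓝[>] 0) (𝓝 0) := by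
    have hid : Tendsto (fun ε : ℝ => ε) (𝓝[>] 0) (𝓝 0) := tendsto_id.mono_left nhdsWithin_le_nhds
    simpa using hid.mul_const (∫ x, |F x| ∂μ)
  exact norm_le_zero_iff.1 (ge_of_tendsto hlim (eventually_mem_nhdsWithin.mono hbound))

theorem ae_eq_zero_of_integral_mul_cos_pow_eq_zero {F : ℝ → ℝ} (hF : IntegrableOn F (Icc 0 1))
    (h : ∀ j : ℕ, ∫ x in Icc (0 : ℝ) 1, F x * Real.cos (Real.pi * x) ^ j = 0) :
    ∀ᵐ x ∂(volume.restrict (Icc (0 : ℝ) 1)), F x = 0 := by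
  have hpoly (p : Polynomial ℝ) :
      ∫ x in Icc (0 : ℝ) 1, F x * p.eval (Real.cos (Real.pi * x)) = 0 := by
    simp_rw [Polynomial.eval_eq_sum_range, Finset.mul_sum, mul_left_comm (F _)]
    rw [integral_finsetSum _ fun j _ => (hF.mul_continuousOn
      (Continuous.continuousOn (by fun_prop)) isCompact_Icc).const_mul _]
    exact Finset.sum_eq_zero fun j _ => by rw [integral_const_mul, h, mul_zero]
  refine (ae_restrict_iff' measurableSet_Icc).2 ?_
  suffices hind : ∀ᵐ x, (Icc (0 : ℝ) 1).indicator F x = 0 by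
    filter_upwards [hind] with x hx hxI
    rwa [indicator_of_mem hxI] at hx
  refine ae_eq_zero_of_integral_contDiff_smul_eq_zero
    (hF.integrable_indicator measurableSet_Icc).locallyIntegrable fun ψ hψ _ => ?_
  have hψ' : Continuous fun r => ψ (Real.arccos r / Real.pi) :=
    hψ.continuous.comp (Real.continuous_arccos.div_const _)
  refine Eq.trans ?_ (integral_mul_comp_eq_zero_of_polynomial hF
    (Continuous.aestronglyMeasurable (by fun_prop))
    (fun x => ⟨Real.neg_one_le_cos _, Real.cos_le_one _⟩) hpoly hψ')
  rw [← integral_indicator measurableSet_Icc]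
  congr 1 with x
  by_cases hx : x ∈ Icc (0 : ℝ) 1
  · rw [indicator_of_mem hx, indicator_of_mem hx, Real.arccos_cos
      (mul_nonneg Real.pi_pos.le hx.1) (mul_le_of_le_one_right Real.pi_pos.le hx.2),
      mul_div_cancel_left₀ _ Real.pi_ne_zero, smul_eq_mul, mul_comm]
  · rw [indicator_of_notMem hx, indicator_of_notMem hx, smul_zero]

theorem integral_mul_cos_pow_mul_sin_eq_zero {F : ℝ → ℝ} (hF : IntegrableOn F (Icc 0 1))
    (h : ∀ n : ℤ, ∫ x in Icc (0 : ℝ) 1, F x * Real.sin (n * Real.pi * x) = 0) (j : ℕ) (n : ℤ) :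
    ∫ x in Icc (0 : ℝ) 1, F x * (Real.cos (Real.pi * x) ^ j * Real.sin (n * Real.pi * x)) = 0 := by
  induction j generalizing n with
  | zero => simpa using h n
  | succ j ih =>
    have hstep (x : ℝ) :
        F x * (Real.cos (Real.pi * x) ^ (j + 1) * Real.sin (n * Real.pi * x)) = 1 / 2 *
          (F x * (Real.cos (Real.pi * x) ^ j * Real.sin (((n + 1 : ℤ) : ℝ) * Real.pi * x)) +
            F x * (Real.cos (Real.pi * x) ^ j *
              Real.sin (((n - 1 : ℤ) : ℝ) * Real.pi * x))) := by
      push_cast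
      rw [add_mul (n : ℝ), add_mul, sub_mul (n : ℝ), sub_mul, one_mul, Real.sin_add, Real.sin_sub]
      ring
    have hInt (i : ℤ) : IntegrableOn (fun x => F x *
        (Real.cos (Real.pi * x) ^ j * Real.sin (i * Real.pi * x))) (Icc 0 1) :=
      hF.mul_continuousOn (Continuous.continuousOn (by fun_prop)) isCompact_Icc
    simp_rw [hstep]
    rw [integral_const_mul, integral_add (hInt _) (hInt _), ih, ih, add_zero, mul_zero]

theorem ae_eq_zero_of_integral_mul_sin_eq_zero {F : ℝ → ℝ} (hF : IntegrableOn F (Icc 0 1))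
    (h : ∀ n : ℕ, ∫ x in Icc (0 : ℝ) 1, F x * Real.sin ((n + 1) * Real.pi * x) = 0) :
    ∀ᵐ x ∂(volume.restrict (Icc (0 : ℝ) 1)), F x = 0 := by
  have hInt (n : ℤ) : ∫ x in Icc (0 : ℝ) 1, F x * Real.sin (n * Real.pi * x) = 0 := by
    rcases n with (_ | n) | n
    · simp
    · simpa using h n
    · have hneg : ((Int.negSucc n : ℤ) : ℝ) = -((n : ℝ) + 1) := by
        rw [Int.cast_negSucc]; push_cast; ring
      simp_rw [hneg, neg_mul, Real.sin_neg, mul_neg]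
      rw [integral_neg, h n, neg_zero]
  have hmul : ∀ᵐ x ∂(volume.restrict (Icc (0 : ℝ) 1)), F x * Real.sin (Real.pi * x) = 0 := by
    refine ae_eq_zero_of_integral_mul_cos_pow_eq_zero
      (hF.mul_continuousOn (Continuous.continuousOn (by fun_prop)) isCompact_Icc) fun j => ?_
    simpa only [Int.cast_one, one_mul, mul_assoc, mul_comm (Real.sin _)] using
      integral_mul_cos_pow_mul_sin_eq_zero hF hInt j 1
  rw [← restrict_Ioo_eq_restrict_Icc] at hmul ⊢
  filter_upwards [hmul, ae_restrict_mem measurableSet_Ioo] with x hx hxI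
  exact (mul_eq_zero.1 hx).resolve_right (Real.sin_pos_of_pos_of_lt_pi
    (mul_pos Real.pi_pos hxI.1) (mul_lt_of_lt_one_right Real.pi_pos hxI.2)).ne'

end SineCompleteness

section SineBasis

/-- The square roots `(n + 1) π` of the eigenvalues of `-∂²/∂x²` on `[0,1]` with Dirichlet boundary
conditions, indexed from `n = 0`. -/
noncomputable def sineFreq (n : ℕ) : ℝ := ((n : ℝ) + 1) * Real.pi

/-- The Dirichlet eigenfunctions `√2 sin((n + 1) π x)`, normalized in `L²([0,1])`. -/
noncomputable def sineFun (n : ℕ) (x : ℝ) : ℝ := √2 * Real.sin (sineFreq n * x)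

/-- The derivatives of the normalized Dirichlet eigenfunctions. -/
noncomputable def sineFunDeriv (n : ℕ) (x : ℝ) : ℝ := √2 * (sineFreq n * Real.cos (sineFreq n * x))

theorem sineFreq_pos (n : ℕ) : 0 < sineFreq n := mul_pos n.cast_add_one_pos Real.pi_pos

theorem one_le_sineFreq (n : ℕ) : 1 ≤ sineFreq n :=
  one_le_mul_of_one_le_of_one_le (le_add_of_nonneg_left n.cast_nonneg)
    (by linarith [Real.pi_gt_three])

theorem summable_inv_sineFreq_sq : Summable fun n => (sineFreq n ^ 2)⁻¹ := by
  have h : Summable fun n : ℕ => (((n + 1 : ℕ) : ℝ) ^ 2)⁻¹ :=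
    (summable_nat_add_iff 1).2 (Real.summable_nat_pow_inv.2 one_lt_two)
  simpa only [sineFreq, mul_pow, mul_inv, Nat.cast_add_one] using h.mul_right (Real.pi ^ 2)⁻¹

theorem continuous_sineFun (n : ℕ) : Continuous (sineFun n) := by
  unfold sineFun; fun_prop

theorem continuous_sineFunDeriv (n : ℕ) : Continuous (sineFunDeriv n) := by
  unfold sineFunDeriv; fun_prop

theorem hasDerivAt_sineFun (n : ℕ) (x : ℝ) : HasDerivAt (sineFun n) (sineFunDeriv n x) x := by
  have h : HasDerivAt (fun x => sineFreq n * x) (sineFreq n) x := hasDerivAt_const_mul _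
  exact (h.sin.const_mul √2).congr_deriv (by rw [sineFunDeriv, mul_comm (Real.cos _)])

theorem abs_sineFun_le (n : ℕ) (x : ℝ) : |sineFun n x| ≤ √2 := by
  rw [sineFun, abs_mul, abs_of_nonneg (Real.sqrt_nonneg 2)]
  exact mul_le_of_le_one_right (Real.sqrt_nonneg 2) (Real.abs_sin_le_one _)

theorem abs_sineFunDeriv_le (n : ℕ) (x : ℝ) : |sineFunDeriv n x| ≤ √2 * sineFreq n := by
  rw [sineFunDeriv, abs_mul, abs_of_nonneg (Real.sqrt_nonneg 2), abs_mul,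
    abs_of_pos (sineFreq_pos n)]
  exact mul_le_mul_of_nonneg_left
    (mul_le_of_le_one_right (sineFreq_pos n).le (Real.abs_cos_le_one _)) (Real.sqrt_nonneg 2)

theorem sineFun_zero (n : ℕ) : sineFun n 0 = 0 := by simp [sineFun]

theorem sineFun_one (n : ℕ) : sineFun n 1 = 0 := by
  have : Real.sin (((n + 1 : ℕ) : ℝ) * Real.pi) = 0 := Real.sin_nat_mul_pi _
  push_cast at this
  simp [sineFun, sineFreq, this]

theorem integral_cos_int_mul_pi_mul (j : ℤ) :
    ∫ x in (0 : ℝ)..1, Real.cos (j * Real.pi * x) = if j = 0 then 1 else 0 := by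
  split_ifs with hj
  · simp [hj]
  · have : (j : ℝ) * Real.pi ≠ 0 := mul_ne_zero (by exact_mod_cast hj) Real.pi_ne_zero
    rw [intervalIntegral.integral_comp_mul_left (fun x => Real.cos x) this]
    simp [Real.sin_int_mul_pi]

theorem integral_cos_sineFreq_sub (n m : ℕ) :
    ∫ x in Icc (0 : ℝ) 1, Real.cos (sineFreq n * x - sineFreq m * x) = if n = m then 1 else 0 := by
  have hfreq (x : ℝ) : sineFreq n * x - sineFreq m * x = ((n - m : ℤ) : ℝ) * Real.pi * x := by
    simp only [sineFreq]; push_cast; ring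
  simp_rw [integral_Icc_eq_integral_Ioc, ← intervalIntegral.integral_of_le zero_le_one, hfreq,
    integral_cos_int_mul_pi_mul, sub_eq_zero, Nat.cast_inj]

theorem integral_cos_sineFreq_add (n m : ℕ) :
    ∫ x in Icc (0 : ℝ) 1, Real.cos (sineFreq n * x + sineFreq m * x) = 0 := by
  have hfreq (x : ℝ) : sineFreq n * x + sineFreq m * x = ((n + m + 2 : ℤ) : ℝ) * Real.pi * x := by
    simp only [sineFreq]; push_cast; ring
  simp_rw [integral_Icc_eq_integral_Ioc, ← intervalIntegral.integral_of_le zero_le_one, hfreq,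
    integral_cos_int_mul_pi_mul]
  exact if_neg (by omega)

theorem integrableOn_cos_of_continuous {φ : ℝ → ℝ} (hφ : Continuous φ) :
    IntegrableOn (fun x => Real.cos (φ x)) (Icc 0 1) :=
  (Real.continuous_cos.comp hφ).integrableOn_Icc

theorem integral_sineFun_mul (n m : ℕ) :
    ∫ x in Icc (0 : ℝ) 1, sineFun n x * sineFun m x = if n = m then 1 else 0 := by
  have hprod (x : ℝ) : sineFun n x * sineFun m x =
      Real.cos (sineFreq n * x - sineFreq m * x) - Real.cos (sineFreq n * x + sineFreq m * x) := by
    rw [sineFun, sineFun, mul_mul_mul_comm, Real.mul_self_sqrt zero_le_two, Real.cos_sub,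
      Real.cos_add]
    ring
  simp_rw [hprod]
  rw [integral_sub (integrableOn_cos_of_continuous (by fun_prop))
    (integrableOn_cos_of_continuous (by fun_prop)), integral_cos_sineFreq_sub,
    integral_cos_sineFreq_add, sub_zero]

theorem integral_sineFunDeriv_mul (n m : ℕ) :
    ∫ x in Icc (0 : ℝ) 1, sineFunDeriv n x * sineFunDeriv m x =
      if n = m then sineFreq n ^ 2 else 0 := by
  have hprod (x : ℝ) : sineFunDeriv n x * sineFunDeriv m x = sineFreq n * sineFreq m *
      (Real.cos (sineFreq n * x - sineFreq m * x) +
        Real.cos (sineFreq n * x + sineFreq m * x)) := by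
    rw [sineFunDeriv, sineFunDeriv, mul_mul_mul_comm, Real.mul_self_sqrt zero_le_two, Real.cos_sub,
      Real.cos_add]
    ring
  simp_rw [hprod]
  rw [integral_const_mul, integral_add (integrableOn_cos_of_continuous (by fun_prop))
    (integrableOn_cos_of_continuous (by fun_prop)), integral_cos_sineFreq_sub,
    integral_cos_sineFreq_add, add_zero]
  split_ifs with hnm
  · rw [hnm, mul_one, sq]
  · exact mul_zero _

theorem ae_eq_zero_of_integral_mul_sineFun_eq_zero {F : ℝ → ℝ} (hF : IntegrableOn F (Icc 0 1))
    (h : ∀ n, ∫ x in Icc (0 : ℝ) 1, F x * sineFun n x = 0) :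
    ∀ᵐ x ∂(volume.restrict (Icc (0 : ℝ) 1)), F x = 0 := by
  refine ae_eq_zero_of_integral_mul_sin_eq_zero hF fun n => ?_
  have hn := h n
  simp_rw [sineFun, mul_left_comm _ √2, integral_const_mul] at hn
  exact (mul_eq_zero.1 hn).resolve_left (by positivity)

theorem memLp_sineFun (n : ℕ) : MemLp (sineFun n) 2 (volume.restrict (Icc (0 : ℝ) 1)) :=
  MemLp.of_bound (continuous_sineFun n).aestronglyMeasurable √2 (ae_of_all _ (abs_sineFun_le n))

/-- The eigenfunction `sineFun n` as an element of `L²([0,1])`. -/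
noncomputable def sineVec (n : ℕ) : L2I := (memLp_sineFun n).toLp

theorem coeFn_sineVec (n : ℕ) : sineVec n =ᵐ[volume.restrict (Icc (0 : ℝ) 1)] sineFun n :=
  (memLp_sineFun n).coeFn_toLp

theorem inner_sineVec (n : ℕ) (w : L2I) :
    inner ℝ (sineVec n) w = ∫ x in Icc (0 : ℝ) 1, w x * sineFun n x := by
  rw [L2.inner_def]
  refine integral_congr_ae ?_
  filter_upwards [coeFn_sineVec n] with x hx
  rw [hx]
  simp

theorem orthonormal_sineVec : Orthonormal ℝ sineVec := by
  rw [orthonormal_iff_ite]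
  intro n m
  rw [inner_sineVec, ← integral_sineFun_mul n m]
  refine integral_congr_ae ?_
  filter_upwards [coeFn_sineVec m] with x hx
  rw [hx, mul_comm]

theorem integrableOn_coeFn_L2I (w : L2I) : IntegrableOn w (Icc 0 1) :=
  (Lp.memLp w).integrable one_le_two

theorem orthogonal_span_sineVec : (Submodule.span ℝ (range sineVec))ᗮ = ⊥ := by
  rw [Submodule.eq_bot_iff]
  intro w hw
  refine (Lp.eq_zero_iff_ae_eq_zero).2 (ae_eq_zero_of_integral_mul_sineFun_eq_zero
    (integrableOn_coeFn_L2I w) fun n => ?_)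
  rw [← inner_sineVec]
  exact (Submodule.mem_orthogonal _ _).1 hw _ (Submodule.subset_span (mem_range_self n))

/-- The Hilbert basis of `L²([0,1])` formed by the Dirichlet eigenfunctions. -/
noncomputable def sineBasis : HilbertBasis ℕ ℝ L2I :=
  HilbertBasis.mkOfOrthogonalEqBot orthonormal_sineVec orthogonal_span_sineVec

theorem coeFn_sineBasis (n : ℕ) : sineBasis n =ᵐ[volume.restrict (Icc (0 : ℝ) 1)] sineFun n := by
  rw [sineBasis, HilbertBasis.coe_mkOfOrthogonalEqBot]
  exact coeFn_sineVec n

theorem inner_sineBasis (n : ℕ) (w : L2I) :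
    inner ℝ (sineBasis n) w = ∫ x in Icc (0 : ℝ) 1, w x * sineFun n x := by
  rw [← inner_sineVec, sineBasis, HilbertBasis.coe_mkOfOrthogonalEqBot]

end SineBasis

section L2Bounds

theorem norm_sq_L2I (w : L2I) : ‖w‖ ^ 2 = ∫ x in Icc (0 : ℝ) 1, w x ^ 2 := by
  rw [← real_inner_self_eq_norm_sq, L2.inner_def]
  simp only [real_inner_self_eq_norm_sq, Real.norm_eq_abs, sq_abs]

theorem sqrt_integral_sq_L2I (w : L2I) : √(∫ x in Icc (0 : ℝ) 1, w x ^ 2) = ‖w‖ := by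
  rw [← norm_sq_L2I, Real.sqrt_sq (norm_nonneg _)]

theorem integral_abs_L2I_le (w : L2I) : ∫ x in Icc (0 : ℝ) 1, |w x| ≤ ‖w‖ := by
  have h := integral_abs_mul_abs_le_sqrt_mul_sqrt
    (memLp_const (1 : ℝ) (μ := volume.restrict (Icc (0 : ℝ) 1))) (Lp.memLp w)
  simpa [sqrt_integral_sq_L2I] using h

theorem integrableOn_abs_mul_abs_L2I (w z : L2I) :
    IntegrableOn (fun x => |w x| * |z x|) (Icc 0 1) :=
  (Lp.memLp w).abs.integrable_mul (Lp.memLp z).abs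

theorem integral_abs_mul_abs_L2I_le (w z : L2I) :
    ∫ x in Icc (0 : ℝ) 1, |w x| * |z x| ≤ ‖w‖ * ‖z‖ := by
  simpa only [sqrt_integral_sq_L2I] using
    integral_abs_mul_abs_le_sqrt_mul_sqrt (Lp.memLp w) (Lp.memLp z)

theorem integrableOn_growth_mul_L2I (w z q : L2I) :
    IntegrableOn (fun x => (1 + |w x| + |z x|) * |q x|) (Icc 0 1) := by
  simp_rw [add_mul, one_mul]
  exact ((integrableOn_coeFn_L2I q).abs.add (integrableOn_abs_mul_abs_L2I w q)).add
    (integrableOn_abs_mul_abs_L2I z q)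

theorem integral_growth_mul_L2I_le (w z q : L2I) :
    ∫ x in Icc (0 : ℝ) 1, (1 + |w x| + |z x|) * |q x| ≤ (1 + ‖w‖ + ‖z‖) * ‖q‖ := by
  simp_rw [add_mul, one_mul]
  rw [integral_add
    (by exact (integrableOn_coeFn_L2I q).abs.add (integrableOn_abs_mul_abs_L2I w q))
    (integrableOn_abs_mul_abs_L2I z q),
    integral_add (integrableOn_coeFn_L2I q).abs (integrableOn_abs_mul_abs_L2I w q)]
  exact add_le_add_three (integral_abs_L2I_le q) (integral_abs_mul_abs_L2I_le w q)
    (integral_abs_mul_abs_L2I_le z q)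

theorem measurable_coeFn_L2I (w : L2I) : Measurable w := (Lp.stronglyMeasurable w).measurable

end L2Bounds

section ControlNorm

/-- The weight `1 + ‖v(s,·)‖` controlling the time section of `v ∈ L²([0,T] × [0,1])`. -/
noncomputable def controlNorm {T : ℝ} (v : L2TI T) (s : ℝ) : ℝ :=
  1 + √(∫ y in Icc (0 : ℝ) 1, v (s, y) ^ 2)

variable {T : ℝ} (v : L2TI T)

theorem measurable_coeFn_L2TI : Measurable v := (Lp.stronglyMeasurable v).measurable

theorem integrable_sq_L2TI : Integrable (fun p => v p ^ 2)
    ((volume.restrict (Icc (0 : ℝ) T)).prod (volume.restrict (Icc (0 : ℝ) 1))) := by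
  rw [Measure.prod_restrict]
  exact (Lp.memLp v).integrable_sq

theorem ae_memLp_section_L2TI : ∀ᵐ s ∂(volume.restrict (Ioc (0 : ℝ) T)),
    MemLp (fun y => v (s, y)) 2 (volume.restrict (Icc (0 : ℝ) 1)) := by
  rw [restrict_Ioc_eq_restrict_Icc]
  filter_upwards [(integrable_sq_L2TI v).prod_right_ae] with s hs
  exact (memLp_two_iff_integrable_sq
    ((measurable_coeFn_L2TI v).comp measurable_prodMk_left).aestronglyMeasurable).2 hs

theorem one_le_controlNorm (s : ℝ) : 1 ≤ controlNorm v s :=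
  le_add_of_nonneg_right (Real.sqrt_nonneg _)

theorem memLp_controlNorm : MemLp (controlNorm v) 2 (volume.restrict (Ioc 0 T)) := by
  have hm : Measurable fun s => ∫ y in Icc (0 : ℝ) 1, v (s, y) ^ 2 :=
    (StronglyMeasurable.integral_prod_right'
      ((measurable_coeFn_L2TI v).pow_const 2).stronglyMeasurable).measurable
  refine (memLp_const (1 : ℝ)).add ?_
  rw [memLp_two_iff_integrable_sq hm.sqrt.aestronglyMeasurable]
  simp_rw [Real.sq_sqrt (integral_nonneg fun y => sq_nonneg (v (_, y)))]
  rw [restrict_Ioc_eq_restrict_Icc]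
  exact (integrable_sq_L2TI v).integral_prod_left

theorem one_add_integral_sq_le_controlNorm_sq (s : ℝ) :
    1 + ∫ y in Icc (0 : ℝ) 1, v (s, y) ^ 2 ≤ controlNorm v s ^ 2 := by
  have h : 0 ≤ ∫ y in Icc (0 : ℝ) 1, v (s, y) ^ 2 := integral_nonneg fun y => sq_nonneg _
  rw [controlNorm, add_sq, Real.sq_sqrt h]
  linarith [Real.sqrt_nonneg (∫ y in Icc (0 : ℝ) 1, v (s, y) ^ 2)]

variable {v}

theorem integral_abs_section_le_controlNorm {s : ℝ}
    (hv : MemLp (fun y => v (s, y)) 2 (volume.restrict (Icc (0 : ℝ) 1))) :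
    ∫ y in Icc (0 : ℝ) 1, |v (s, y)| ≤ controlNorm v s := by
  have h : ∫ y in Icc (0 : ℝ) 1, |v (s, y)| ≤ √(∫ y in Icc (0 : ℝ) 1, v (s, y) ^ 2) := by
    simpa using integral_abs_mul_abs_le_sqrt_mul_sqrt (memLp_const (1 : ℝ)) hv
  exact h.trans (le_add_of_nonneg_left zero_le_one)

end ControlNorm

section IntegralBounds

theorem abs_integral_mul_le {p e : ℝ → ℝ} {B : ℝ} (hp : IntegrableOn p (Icc 0 1))
    (heB : ∀ y, |e y| ≤ B) :
    |∫ y in Icc (0 : ℝ) 1, p y * e y| ≤ B * ∫ y in Icc (0 : ℝ) 1, |p y| := by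
  rw [← integral_const_mul, ← Real.norm_eq_abs]
  refine norm_integral_le_of_norm_le (hp.abs.const_mul B) (ae_of_all _ fun y => ?_)
  rw [norm_mul, mul_comm]
  exact mul_le_mul_of_nonneg_right (heB y) (norm_nonneg _)

theorem abs_integral_mul_sub_le {p q e : ℝ → ℝ} {B : ℝ} (hp : IntegrableOn p (Icc 0 1))
    (hq : IntegrableOn q (Icc 0 1)) (he : Continuous e) (heB : ∀ y, |e y| ≤ B) :
    |(∫ y in Icc (0 : ℝ) 1, p y * e y) - ∫ y in Icc (0 : ℝ) 1, q y * e y| ≤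
      B * ∫ y in Icc (0 : ℝ) 1, |p y - q y| := by
  rw [← integral_sub (hp.mul_continuousOn he.continuousOn isCompact_Icc)
    (hq.mul_continuousOn he.continuousOn isCompact_Icc)]
  simp_rw [← sub_mul]
  exact abs_integral_mul_le (hp.sub hq) heB

theorem integral_abs_comp_sub_le {φ : ℝ → ℝ → ℝ} {L : ℝ}
    (hφ : ∀ y ∈ Icc (0 : ℝ) 1, ∀ p q, |φ y p - φ y q| ≤ L * (1 + |p| + |q|) * |p - q|)
    (hL : 0 ≤ L) (w z : L2I) :
    ∫ y in Icc (0 : ℝ) 1, |φ y (w y) - φ y (z y)| ≤ L * ((1 + ‖w‖ + ‖z‖) * ‖w - z‖) := by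
  refine le_trans ?_ (mul_le_mul_of_nonneg_left (integral_growth_mul_L2I_le w z (w - z)) hL)
  rw [← integral_const_mul]
  refine integral_mono_of_nonneg (ae_of_all _ fun y => abs_nonneg _)
    ((integrableOn_growth_mul_L2I w z (w - z)).const_mul L) ?_
  filter_upwards [ae_restrict_mem measurableSet_Icc, Lp.coeFn_sub w z] with y hy hsub
  rw [hsub, Pi.sub_apply, ← mul_assoc]
  exact hφ y hy _ _

theorem integral_abs_comp_mul_sub_le {φ : ℝ → ℝ → ℝ} {L : ℝ}
    (hφ : ∀ y ∈ Icc (0 : ℝ) 1, ∀ p q, |φ y p - φ y q| ≤ L * |p - q|) (hL : 0 ≤ L) (w z : L2I)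
    {ν : ℝ → ℝ} (hν : MemLp ν 2 (volume.restrict (Icc (0 : ℝ) 1))) :
    ∫ y in Icc (0 : ℝ) 1, |φ y (w y) * ν y - φ y (z y) * ν y| ≤
      L * (‖w - z‖ * √(∫ y in Icc (0 : ℝ) 1, ν y ^ 2)) := by
  have hle := integral_abs_mul_abs_le_sqrt_mul_sqrt (Lp.memLp (w - z)) hν
  rw [sqrt_integral_sq_L2I] at hle
  refine le_trans ?_ (mul_le_mul_of_nonneg_left hle hL)
  rw [← integral_const_mul]
  refine integral_mono_of_nonneg (ae_of_all _ fun y => abs_nonneg _)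
    (((Lp.memLp (w - z)).abs.integrable_mul hν.abs).const_mul L) ?_
  filter_upwards [ae_restrict_mem measurableSet_Icc, Lp.coeFn_sub w z] with y hy hsub
  rw [hsub, Pi.sub_apply, ← mul_assoc, ← sub_mul, abs_mul]
  exact mul_le_mul_of_nonneg_right (hφ y hy _ _) (abs_nonneg _)

theorem stronglyMeasurable_integral_comp_L2I {u : ℝ → L2I} (hu : Continuous u)
    {Ψ : ℝ × ℝ × ℝ → ℝ} (hΨ : Measurable Ψ) :
    StronglyMeasurable fun s => ∫ y in Icc (0 : ℝ) 1, Ψ (s, y, u s y) := by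
  obtain ⟨φ, hφ, hφu⟩ := exists_measurable_version hu
  have hcongr (s : ℝ) :
      ∫ y in Icc (0 : ℝ) 1, Ψ (s, y, u s y) = ∫ y in Icc (0 : ℝ) 1, Ψ (s, y, φ (s, y)) :=
    integral_congr_ae ((hφu s).mono fun y hy => congrArg (fun r => Ψ (s, y, r)) hy)
  simp_rw [hcongr]
  exact (hΨ.comp (measurable_fst.prodMk
    (measurable_snd.prodMk hφ))).stronglyMeasurable.integral_prod_right'

end IntegralBounds

section SkeletonNonlinearity

/-- The coefficients `f, g, σ` of the skeleton equation are measurable, satisfy growth and Lipschitz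
bounds with constants `K, L, M` on `[0,T] × [0,1]`, and the superlinear part of `g` does not depend
on the space variable: this is how the decomposition `g = g₁ + g₂` enters. -/
structure IsSkeletonCoefficients (T : ℝ) (f g σ : ℝ → ℝ → ℝ → ℝ) (K L M : ℝ) : Prop where
  K_nonneg : 0 ≤ K
  L_nonneg : 0 ≤ L
  M_nonneg : 0 ≤ M
  measurable_f : Measurable fun p : ℝ × ℝ × ℝ => f p.1 p.2.1 p.2.2
  measurable_g : Measurable fun p : ℝ × ℝ × ℝ => g p.1 p.2.1 p.2.2
  measurable_σ : Measurable fun p : ℝ × ℝ × ℝ => σ p.1 p.2.1 p.2.2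
  f_growth : ∀ t ∈ Icc 0 T, ∀ x ∈ Icc (0 : ℝ) 1, ∀ r, |f t x r| ≤ K * (1 + |r|)
  g_growth : ∀ t ∈ Icc 0 T, ∀ x ∈ Icc (0 : ℝ) 1, ∀ r, |g t x r| ≤ 3 * K * (1 + r ^ 2)
  g_osc : ∀ t ∈ Icc 0 T, ∀ x ∈ Icc (0 : ℝ) 1, ∀ r, |g t x r - g t 0 r| ≤ 2 * K * (1 + |r|)
  σ_bdd : ∀ t ∈ Icc 0 T, ∀ x ∈ Icc (0 : ℝ) 1, ∀ r, |σ t x r| ≤ M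
  σ_lip : ∀ t ∈ Icc 0 T, ∀ x ∈ Icc (0 : ℝ) 1, ∀ p q, |σ t x p - σ t x q| ≤ L * |p - q|
  f_lip : ∀ t ∈ Icc 0 T, ∀ x ∈ Icc (0 : ℝ) 1, ∀ p q,
    |f t x p - f t x q| ≤ L * (1 + |p| + |q|) * |p - q|
  g_lip : ∀ t ∈ Icc 0 T, ∀ x ∈ Icc (0 : ℝ) 1, ∀ p q,
    |g t x p - g t x q| ≤ L * (1 + |p| + |q|) * |p - q|

/-- The `n`-th sine coefficient of `∂_y g(s,y,w) + f(s,y,w) + σ(s,y,w) v(s,y)`, the derivative being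
taken in the weak sense. -/
noncomputable def skeletonCoeff {T : ℝ} (f g σ : ℝ → ℝ → ℝ → ℝ) (v : L2TI T) (n : ℕ) (s : ℝ)
    (w : L2I) : ℝ :=
  -(∫ y in Icc (0 : ℝ) 1, g s y (w y) * sineFunDeriv n y) +
    (∫ y in Icc (0 : ℝ) 1, f s y (w y) * sineFun n y) +
    ∫ y in Icc (0 : ℝ) 1, σ s y (w y) * v (s, y) * sineFun n y

namespace IsSkeletonCoefficients

variable {T : ℝ} {v : L2TI T} {f g σ : ℝ → ℝ → ℝ → ℝ} {K L M : ℝ}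

theorem integrableOn_f (hc : IsSkeletonCoefficients T f g σ K L M) {s : ℝ} (hs : s ∈ Icc 0 T)
    (w : L2I) : IntegrableOn (fun y => f s y (w y)) (Icc 0 1) := by
  have hInt : IntegrableOn (fun y => K * (1 + |w y|)) (Icc 0 1) :=
    ((integrable_const _).add (integrableOn_coeFn_L2I w).abs).const_mul _
  refine Integrable.mono' hInt (hc.measurable_f.comp (measurable_const.prodMk
    (measurable_id.prodMk (measurable_coeFn_L2I w)))).aestronglyMeasurable ?_
  filter_upwards [ae_restrict_mem measurableSet_Icc] with y hy
  exact hc.f_growth s hs y hy _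

theorem integrableOn_g (hc : IsSkeletonCoefficients T f g σ K L M) {s : ℝ} (hs : s ∈ Icc 0 T)
    (w : L2I) : IntegrableOn (fun y => g s y (w y)) (Icc 0 1) := by
  have hInt : IntegrableOn (fun y => 3 * K * (1 + w y ^ 2)) (Icc 0 1) :=
    ((integrable_const _).add (Lp.memLp w).integrable_sq).const_mul _
  refine Integrable.mono' hInt (hc.measurable_g.comp (measurable_const.prodMk
    (measurable_id.prodMk (measurable_coeFn_L2I w)))).aestronglyMeasurable ?_
  filter_upwards [ae_restrict_mem measurableSet_Icc] with y hy
  exact hc.g_growth s hs y hy _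

theorem integrableOn_σ_mul (hc : IsSkeletonCoefficients T f g σ K L M) {s : ℝ} (hs : s ∈ Icc 0 T)
    (hv : MemLp (fun y => v (s, y)) 2 (volume.restrict (Icc (0 : ℝ) 1))) (w : L2I) :
    IntegrableOn (fun y => σ s y (w y) * v (s, y)) (Icc 0 1) := by
  refine (hv.integrable one_le_two).bdd_mul (hc.measurable_σ.comp (measurable_const.prodMk
    (measurable_id.prodMk (measurable_coeFn_L2I w)))).aestronglyMeasurable (c := M) ?_
  filter_upwards [ae_restrict_mem measurableSet_Icc] with y hy
  exact hc.σ_bdd s hs y hy _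

theorem integral_abs_g_le (hc : IsSkeletonCoefficients T f g σ K L M) {s : ℝ} (hs : s ∈ Icc 0 T)
    (w : L2I) : ∫ y in Icc (0 : ℝ) 1, |g s y (w y)| ≤ 3 * K * (1 + ‖w‖ ^ 2) := by
  calc ∫ y in Icc (0 : ℝ) 1, |g s y (w y)|
      ≤ ∫ y in Icc (0 : ℝ) 1, 3 * K * (1 + w y ^ 2) :=
        setIntegral_mono_on (hc.integrableOn_g hs w).abs
          (by exact ((integrable_const _).add (Lp.memLp w).integrable_sq).const_mul _)
          measurableSet_Icc
          fun y hy => hc.g_growth s hs y hy (w y)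
    _ = 3 * K * (1 + ‖w‖ ^ 2) := by
        rw [integral_const_mul, integral_add (integrable_const _) (Lp.memLp w).integrable_sq,
          norm_sq_L2I]
        simp

theorem integral_abs_f_le (hc : IsSkeletonCoefficients T f g σ K L M) {s : ℝ} (hs : s ∈ Icc 0 T)
    (w : L2I) : ∫ y in Icc (0 : ℝ) 1, |f s y (w y)| ≤ K * (1 + ‖w‖) := by
  calc ∫ y in Icc (0 : ℝ) 1, |f s y (w y)| ≤ ∫ y in Icc (0 : ℝ) 1, K * (1 + |w y|) :=
        setIntegral_mono_on (hc.integrableOn_f hs w).abs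
          (((integrable_const _).add (integrableOn_coeFn_L2I w).abs).const_mul _) measurableSet_Icc
          fun y hy => hc.f_growth s hs y hy (w y)
    _ = K * (1 + ∫ y in Icc (0 : ℝ) 1, |w y|) := by
        rw [integral_const_mul, integral_add (integrable_const _) (integrableOn_coeFn_L2I w).abs]
        simp
    _ ≤ K * (1 + ‖w‖) :=
        mul_le_mul_of_nonneg_left (add_le_add_right (integral_abs_L2I_le w) 1) hc.K_nonneg

theorem integral_abs_σ_mul_le (hc : IsSkeletonCoefficients T f g σ K L M) {s : ℝ}
    (hs : s ∈ Icc 0 T) (hv : MemLp (fun y => v (s, y)) 2 (volume.restrict (Icc (0 : ℝ) 1)))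
    (w : L2I) : ∫ y in Icc (0 : ℝ) 1, |σ s y (w y) * v (s, y)| ≤ M * controlNorm v s := by
  calc ∫ y in Icc (0 : ℝ) 1, |σ s y (w y) * v (s, y)|
      ≤ ∫ y in Icc (0 : ℝ) 1, M * |v (s, y)| :=
        setIntegral_mono_on (hc.integrableOn_σ_mul hs hv w).abs
          ((hv.integrable one_le_two).abs.const_mul _) measurableSet_Icc fun y hy => by
            rw [abs_mul]
            exact mul_le_mul_of_nonneg_right (hc.σ_bdd s hs y hy (w y)) (abs_nonneg _)
    _ = M * ∫ y in Icc (0 : ℝ) 1, |v (s, y)| := integral_const_mul _ _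
    _ ≤ M * controlNorm v s :=
        mul_le_mul_of_nonneg_left (integral_abs_section_le_controlNorm hv) hc.M_nonneg

theorem abs_skeletonCoeff_sub_le (hc : IsSkeletonCoefficients T f g σ K L M) {s : ℝ}
    (hs : s ∈ Icc 0 T) (hv : MemLp (fun y => v (s, y)) 2 (volume.restrict (Icc (0 : ℝ) 1)))
    (n : ℕ) (w z : L2I) :
    |skeletonCoeff f g σ v n s w - skeletonCoeff f g σ v n s z| ≤
      √2 * L * (1 + ‖w‖ + ‖z‖) * (sineFreq n + controlNorm v s) * ‖w - z‖ := by
  have hk := sineFreq_pos n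
  set X := L * ((1 + ‖w‖ + ‖z‖) * ‖w - z‖) with hX
  set S := √(∫ y in Icc (0 : ℝ) 1, v (s, y) ^ 2)
  have hg := (abs_integral_mul_sub_le (hc.integrableOn_g hs w) (hc.integrableOn_g hs z)
    (continuous_sineFunDeriv n) (abs_sineFunDeriv_le n)).trans
    (mul_le_mul_of_nonneg_left (integral_abs_comp_sub_le (hc.g_lip s hs) hc.L_nonneg w z)
      (by positivity))
  have hf := (abs_integral_mul_sub_le (hc.integrableOn_f hs w) (hc.integrableOn_f hs z)
    (continuous_sineFun n) (abs_sineFun_le n)).trans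
    (mul_le_mul_of_nonneg_left (integral_abs_comp_sub_le (hc.f_lip s hs) hc.L_nonneg w z)
      (by positivity))
  have hσ := (abs_integral_mul_sub_le (hc.integrableOn_σ_mul hs hv w)
    (hc.integrableOn_σ_mul hs hv z) (continuous_sineFun n) (abs_sineFun_le n)).trans
    (mul_le_mul_of_nonneg_left (integral_abs_comp_mul_sub_le (hc.σ_lip s hs) hc.L_nonneg w z hv)
      (by positivity))
  have hσX : L * (‖w - z‖ * S) ≤ X * S := by
    have hone : ‖w - z‖ ≤ (1 + ‖w‖ + ‖z‖) * ‖w - z‖ :=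
      le_mul_of_one_le_left (norm_nonneg _) (by linarith [norm_nonneg w, norm_nonneg z])
    have := hc.L_nonneg
    rw [hX, mul_assoc]
    gcongr
  calc |skeletonCoeff f g σ v n s w - skeletonCoeff f g σ v n s z|
      ≤ √2 * sineFreq n * X + √2 * X + √2 * (L * (‖w - z‖ * S)) := by
        rw [skeletonCoeff, skeletonCoeff, add_sub_add_comm, add_sub_add_comm, ← neg_sub']
        exact (abs_add_three _ _ _).trans (add_le_add_three ((abs_neg _).trans_le hg) hf hσ)
    _ ≤ √2 * sineFreq n * X + √2 * X + √2 * (X * S) := by gcongr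
    _ = √2 * L * (1 + ‖w‖ + ‖z‖) * (sineFreq n + controlNorm v s) * ‖w - z‖ := by
        rw [controlNorm, hX]; ring

theorem abs_skeletonCoeff_zero_le (hc : IsSkeletonCoefficients T f g σ K L M) {s : ℝ}
    (hs : s ∈ Icc 0 T) (hv : MemLp (fun y => v (s, y)) 2 (volume.restrict (Icc (0 : ℝ) 1)))
    (n : ℕ) :
    |skeletonCoeff f g σ v n s 0| ≤ √2 * (3 * K + M) * (sineFreq n + controlNorm v s) := by
  have hk := sineFreq_pos n
  have hK := hc.K_nonneg
  have hM := hc.M_nonneg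
  have hV := one_le_controlNorm v s
  have hg := (abs_integral_mul_le (hc.integrableOn_g hs 0) (abs_sineFunDeriv_le n)).trans
    (mul_le_mul_of_nonneg_left (hc.integral_abs_g_le hs 0) (by positivity))
  have hf := (abs_integral_mul_le (hc.integrableOn_f hs 0) (abs_sineFun_le n)).trans
    (mul_le_mul_of_nonneg_left (hc.integral_abs_f_le hs 0) (by positivity))
  have hσ := (abs_integral_mul_le (hc.integrableOn_σ_mul hs hv 0) (abs_sineFun_le n)).trans
    (mul_le_mul_of_nonneg_left (hc.integral_abs_σ_mul_le hs hv 0) (by positivity))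
  have hsum : 3 * K * sineFreq n + K + M * controlNorm v s ≤
      (3 * K + M) * (sineFreq n + controlNorm v s) := by nlinarith
  calc |skeletonCoeff f g σ v n s 0|
      ≤ √2 * sineFreq n * (3 * K * (1 + ‖(0 : L2I)‖ ^ 2)) + √2 * (K * (1 + ‖(0 : L2I)‖)) +
          √2 * (M * controlNorm v s) := by
        rw [skeletonCoeff]
        exact (abs_add_three _ _ _).trans (add_le_add_three ((abs_neg _).trans_le hg) hf hσ)
    _ = √2 * (3 * K * sineFreq n + K + M * controlNorm v s) := by rw [norm_zero]; ring
    _ ≤ √2 * (3 * K + M) * (sineFreq n + controlNorm v s) := by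
        rw [mul_assoc √2]
        exact mul_le_mul_of_nonneg_left hsum (Real.sqrt_nonneg 2)

theorem aestronglyMeasurable_skeletonCoeff (hc : IsSkeletonCoefficients T f g σ K L M) (n : ℕ)
    {u : ℝ → L2I} (hu : Continuous u) (μ : Measure ℝ) :
    AEStronglyMeasurable (fun s => skeletonCoeff f g σ v n s (u s)) μ := by
  have he : Measurable fun p : ℝ × ℝ × ℝ => sineFun n p.2.1 :=
    (continuous_sineFun n).measurable.comp (measurable_fst.comp measurable_snd)
  have he' : Measurable fun p : ℝ × ℝ × ℝ => sineFunDeriv n p.2.1 :=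
    (continuous_sineFunDeriv n).measurable.comp (measurable_fst.comp measurable_snd)
  have hv : Measurable fun p : ℝ × ℝ × ℝ => v (p.1, p.2.1) :=
    (measurable_coeFn_L2TI v).comp (measurable_fst.prodMk (measurable_fst.comp measurable_snd))
  exact (((stronglyMeasurable_integral_comp_L2I hu (hc.measurable_g.mul he')).neg.add
    (stronglyMeasurable_integral_comp_L2I hu (hc.measurable_f.mul he))).add
    (stronglyMeasurable_integral_comp_L2I hu
      ((hc.measurable_σ.mul hv).mul he))).aestronglyMeasurable

end IsSkeletonCoefficients

end SkeletonNonlinearity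

section SinePolynomials

/-- The sine polynomial with coefficients `c n` for `n ∈ F`. -/
noncomputable def sinePoly (F : Finset ℕ) (c : ℕ → ℝ) (y : ℝ) : ℝ := ∑ n ∈ F, c n * sineFun n y

/-- The derivative of `sinePoly F c`. -/
noncomputable def sinePolyDeriv (F : Finset ℕ) (c : ℕ → ℝ) (y : ℝ) : ℝ :=
  ∑ n ∈ F, c n * sineFunDeriv n y

variable (F : Finset ℕ) (c : ℕ → ℝ)

theorem continuous_sinePoly : Continuous (sinePoly F c) :=
  continuous_finsetSum _ fun n _ => continuous_const.mul (continuous_sineFun n)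

theorem continuous_sinePolyDeriv : Continuous (sinePolyDeriv F c) :=
  continuous_finsetSum _ fun n _ => continuous_const.mul (continuous_sineFunDeriv n)

theorem hasDerivAt_sinePoly (y : ℝ) : HasDerivAt (sinePoly F c) (sinePolyDeriv F c y) y :=
  HasDerivAt.fun_sum fun n _ => (hasDerivAt_sineFun n y).const_mul (c n)

theorem coeFn_sum_sineBasis :
    (∑ n ∈ F, c n • sineBasis n : L2I) =ᵐ[volume.restrict (Icc (0 : ℝ) 1)] sinePoly F c := by
  filter_upwards [Lp.coeFn_finsetSum F fun n => c n • sineBasis n,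
    ae_all_iff.2 fun n => Lp.coeFn_smul (c n) (sineBasis n), ae_all_iff.2 coeFn_sineBasis]
    with y hsum hsmul hb
  simp only [hsum, Finset.sum_apply, hsmul, Pi.smul_apply, hb, smul_eq_mul, sinePoly]

theorem integral_sq_sum_of_orthogonal {α ι : Type*} [MeasurableSpace α] [DecidableEq ι]
    {μ : Measure α} {ψ : ι → α → ℝ} {κ : ι → ℝ}
    (hψ : ∀ n m, Integrable (fun y => ψ n y * ψ m y) μ)
    (h : ∀ n m, ∫ y, ψ n y * ψ m y ∂μ = if n = m then κ n else 0) (F : Finset ι) (c : ι → ℝ) :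
    ∫ y, (∑ n ∈ F, c n * ψ n y) ^ 2 ∂μ = ∑ n ∈ F, κ n * c n ^ 2 := by
  simp_rw [sq, Finset.sum_mul_sum, mul_mul_mul_comm (c _) (ψ _ _)]
  rw [integral_finsetSum _ fun n _ => integrable_finsetSum _ fun m _ => (hψ n m).const_mul _]
  refine Finset.sum_congr rfl fun n hn => ?_
  rw [integral_finsetSum _ fun m _ => (hψ n m).const_mul _]
  simp_rw [integral_const_mul, h, mul_ite, mul_zero, Finset.sum_ite_eq, if_pos hn, mul_comm]

theorem integral_sq_sinePoly :
    ∫ y in Icc (0 : ℝ) 1, sinePoly F c y ^ 2 = ∑ n ∈ F, c n ^ 2 := by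
  simpa only [one_mul, sinePoly] using integral_sq_sum_of_orthogonal (κ := fun _ => 1)
    (fun n m => ((continuous_sineFun n).mul (continuous_sineFun m)).integrableOn_Icc)
    integral_sineFun_mul F c

theorem integral_sq_sinePolyDeriv :
    ∫ y in Icc (0 : ℝ) 1, sinePolyDeriv F c y ^ 2 = ∑ n ∈ F, sineFreq n ^ 2 * c n ^ 2 :=
  integral_sq_sum_of_orthogonal
    (fun n m => ((continuous_sineFunDeriv n).mul (continuous_sineFunDeriv m)).integrableOn_Icc)
    integral_sineFunDeriv_mul F c

theorem integral_comp_mul_deriv_eq_zero {q W W' : ℝ → ℝ} {a b : ℝ} (hab : a ≤ b)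
    (hq : Continuous q) (hW : ∀ y, HasDerivAt W (W' y) y) (hW' : Continuous W') (h : W a = W b) :
    ∫ y in Icc a b, q (W y) * W' y = 0 := by
  have hsubst := intervalIntegral.integral_comp_mul_deriv (a := a) (b := b) (g := q)
    (fun y _ => hW y) hW'.continuousOn hq
  rw [h, intervalIntegral.integral_same, intervalIntegral.integral_of_le hab,
    ← integral_Icc_eq_integral_Ioc] at hsubst
  exact hsubst

theorem integral_comp_sinePoly_mul_deriv_eq_zero {q : ℝ → ℝ} (hq : Continuous q) :
    ∫ y in Icc (0 : ℝ) 1, q (sinePoly F c y) * sinePolyDeriv F c y = 0 :=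
  integral_comp_mul_deriv_eq_zero zero_le_one hq (hasDerivAt_sinePoly F c)
    (continuous_sinePolyDeriv F c) (by simp [sinePoly, sineFun_zero, sineFun_one])

theorem sum_mul_integral_mul {α ι : Type*} [MeasurableSpace α] {μ : Measure α} {p : α → ℝ}
    {ψ : ι → α → ℝ} (F : Finset ι) (hp : ∀ n ∈ F, Integrable (fun y => p y * ψ n y) μ)
    (c : ι → ℝ) :
    ∑ n ∈ F, c n * ∫ y, p y * ψ n y ∂μ = ∫ y, p y * ∑ n ∈ F, c n * ψ n y ∂μ := by
  simp_rw [Finset.mul_sum, mul_left_comm _ (c _)]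
  rw [integral_finsetSum _ fun n hn => (hp n hn).const_mul (c n)]
  simp_rw [integral_const_mul]

end SinePolynomials

theorem continuous_of_abs_sub_le {q : ℝ → ℝ} {L : ℝ}
    (hq : ∀ x y, |q x - q y| ≤ L * (1 + |x| + |y|) * |x - y|) : Continuous q := by
  refine continuous_iff_continuousAt.2 fun y => tendsto_iff_dist_tendsto_zero.2 ?_
  refine squeeze_zero (fun x => dist_nonneg) (fun x => hq x y) ?_
  have hlim : ContinuousAt (fun x : ℝ => L * (1 + |x| + |y|) * |x - y|) y :=
    Continuous.continuousAt (by fun_prop)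
  simpa [ContinuousAt] using hlim

/-- The dissipation `- p²`, where `p` stands for the space derivative, absorbs the sublinear part
`γ` of the flux. -/
theorem energy_density_le {K M γ φ ρ ν w p : ℝ} (hγ : |γ| ≤ 2 * K * (1 + |w|))
    (hφ : |φ| ≤ K * (1 + |w|)) (hρ : |ρ| ≤ M) :
    -(γ * p) + φ * w + ρ * ν * w - p ^ 2 ≤
      (2 * K ^ 2 + 2 * K + 1 + M ^ 2) * (1 + w ^ 2 + ν ^ 2) := by
  have hK : 0 ≤ K := nonneg_of_mul_nonneg_left ((abs_nonneg φ).trans hφ) (by positivity)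
  have hflux : -(γ * p) - p ^ 2 ≤ 2 * K ^ 2 * (1 + w ^ 2) := by
    have hγsq : γ ^ 2 ≤ (2 * K * (1 + |w|)) ^ 2 := sq_le_sq' (neg_le_of_abs_le hγ) (le_of_abs_le hγ)
    have hwsq : (1 + |w|) ^ 2 ≤ 2 * (1 + w ^ 2) := by
      rw [← sq_abs w]; linarith [sq_nonneg (1 - |w|), add_sq 1 |w|, sub_sq 1 |w|]
    nlinarith [sq_nonneg (γ + 2 * p), mul_le_mul_of_nonneg_left hwsq (sq_nonneg K)]
  have hsource : φ * w ≤ K * (1 + 2 * w ^ 2) := by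
    calc φ * w ≤ |φ| * |w| := (le_abs_self _).trans_eq (abs_mul _ _)
      _ ≤ K * (1 + |w|) * |w| := mul_le_mul_of_nonneg_right hφ (abs_nonneg w)
      _ = K * (|w| + |w| ^ 2) := by ring
      _ ≤ K * (1 + 2 * w ^ 2) := by
        rw [← sq_abs w]
        exact mul_le_mul_of_nonneg_left (by nlinarith [sq_nonneg (|w| - 1 / 2)]) hK
  have hcontrol : ρ * ν * w ≤ M ^ 2 * ν ^ 2 + w ^ 2 := by
    have hρsq : ρ ^ 2 ≤ M ^ 2 := sq_le_sq' (neg_le_of_abs_le hρ) (le_of_abs_le hρ)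
    nlinarith [two_mul_le_add_sq (ρ * ν) w, mul_le_mul_of_nonneg_right hρsq (sq_nonneg ν),
      sq_nonneg (ρ * ν), sq_nonneg w]
  nlinarith [sq_nonneg w, sq_nonneg ν, sq_nonneg K, sq_nonneg M, mul_nonneg hK (sq_nonneg ν),
    mul_nonneg (sq_nonneg K) (sq_nonneg ν), mul_nonneg (sq_nonneg M) (sq_nonneg w)]

namespace IsSkeletonCoefficients

variable {T : ℝ} {v : L2TI T} {f g σ : ℝ → ℝ → ℝ → ℝ} {K L M : ℝ}

theorem sum_mul_skeletonCoeff_sub (hc : IsSkeletonCoefficients T f g σ K L M) {s : ℝ}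
    (hs : s ∈ Icc 0 T) (hv : MemLp (fun y => v (s, y)) 2 (volume.restrict (Icc (0 : ℝ) 1)))
    (w : L2I) {q : ℝ → ℝ} (hq : Continuous q) (F : Finset ℕ) (c : ℕ → ℝ) :
    IntegrableOn (fun y => -((g s y (w y) - q (sinePoly F c y)) * sinePolyDeriv F c y) +
      f s y (w y) * sinePoly F c y + σ s y (w y) * v (s, y) * sinePoly F c y -
      sinePolyDeriv F c y ^ 2) (Icc 0 1) ∧
    ∑ n ∈ F, c n * (skeletonCoeff f g σ v n s w - sineFreq n ^ 2 * c n) =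
      ∫ y in Icc (0 : ℝ) 1, (-((g s y (w y) - q (sinePoly F c y)) * sinePolyDeriv F c y) +
        f s y (w y) * sinePoly F c y + σ s y (w y) * v (s, y) * sinePoly F c y -
        sinePolyDeriv F c y ^ 2) := by
  have hmul {p e : ℝ → ℝ} (hp : IntegrableOn p (Icc 0 1)) (he : Continuous e) :
      IntegrableOn (fun y => p y * e y) (Icc 0 1) :=
    hp.mul_continuousOn he.continuousOn isCompact_Icc
  have hW := continuous_sinePoly F c
  have hW' := continuous_sinePolyDeriv F c
  have hg := hmul (hc.integrableOn_g hs w) hW'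
  have hf := hmul (hc.integrableOn_f hs w) hW
  have hσ := hmul (hc.integrableOn_σ_mul hs hv w) hW
  have hqW : IntegrableOn (fun y => q (sinePoly F c y) * sinePolyDeriv F c y) (Icc 0 1) :=
    ((hq.comp hW).mul hW').integrableOn_Icc
  have hW'sq : IntegrableOn (fun y => sinePolyDeriv F c y ^ 2) (Icc 0 1) :=
    (hW'.pow 2).integrableOn_Icc
  simp_rw [sub_mul]
  refine ⟨(((hg.sub hqW).neg.add hf).add hσ).sub hW'sq, ?_⟩
  rw [integral_sub (by exact ((hg.sub hqW).neg.add hf).add hσ) hW'sq,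
    integral_add (by exact (hg.sub hqW).neg.add hf) hσ,
    integral_add (by exact (hg.sub hqW).neg) hf, integral_neg, integral_sub hg hqW,
    integral_comp_sinePoly_mul_deriv_eq_zero F c hq, sub_zero, integral_sq_sinePolyDeriv]
  simp only [sinePoly, sinePolyDeriv]
  rw [← sum_mul_integral_mul F fun n _ => hmul (hc.integrableOn_g hs w) (continuous_sineFunDeriv n),
    ← sum_mul_integral_mul F fun n _ => hmul (hc.integrableOn_f hs w) (continuous_sineFun n),
    ← sum_mul_integral_mul F fun n _ => hmul (hc.integrableOn_σ_mul hs hv w) (continuous_sineFun n),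
    ← Finset.sum_neg_distrib, ← Finset.sum_add_distrib, ← Finset.sum_add_distrib,
    ← Finset.sum_sub_distrib]
  exact Finset.sum_congr rfl fun n _ => by rw [skeletonCoeff]; ring

theorem sum_mul_skeletonCoeff_sub_le (hc : IsSkeletonCoefficients T f g σ K L M) {s : ℝ}
    (hs : s ∈ Icc 0 T) (hv : MemLp (fun y => v (s, y)) 2 (volume.restrict (Icc (0 : ℝ) 1)))
    (F : Finset ℕ) (c : ℕ → ℝ) {θ : ℝ} (hθ : θ ∈ Icc (0 : ℝ) 1) :
    ∑ n ∈ F, c n * (skeletonCoeff f g σ v n s (θ • ∑ j ∈ F, c j • sineBasis j) -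
      sineFreq n ^ 2 * c n) ≤
      (2 * K ^ 2 + 2 * K + 1 + M ^ 2) * (∑ n ∈ F, c n ^ 2 + controlNorm v s ^ 2) := by
  have hK := hc.K_nonneg
  set w : L2I := θ • ∑ j ∈ F, c j • sineBasis j
  set A := 2 * K ^ 2 + 2 * K + 1 + M ^ 2
  have hwW : ∀ᵐ y ∂(volume.restrict (Icc (0 : ℝ) 1)), w y = θ * sinePoly F c y := by
    filter_upwards [coeFn_sum_sineBasis F c, Lp.coeFn_smul θ (∑ j ∈ F, c j • sineBasis j)]
      with y hsum hsmul
    rw [hsmul, Pi.smul_apply, hsum, smul_eq_mul]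
  -- `g s 0 (θ W)` may be subtracted from the flux, as the integral of `g s 0 (θ W) * W'` vanishes.
  have hq : Continuous fun r => g s 0 (θ * r) :=
    (continuous_of_abs_sub_le (hc.g_lip s hs 0 (left_mem_Icc.2 zero_le_one))).comp
      (continuous_const_mul θ)
  obtain ⟨hInt, hsum⟩ := hc.sum_mul_skeletonCoeff_sub hs hv w hq F c
  have hWsq : IntegrableOn (fun y => sinePoly F c y ^ 2) (Icc 0 1) :=
    ((continuous_sinePoly F c).pow 2).integrableOn_Icc
  calc _ ≤ ∫ y in Icc (0 : ℝ) 1, A * (1 + sinePoly F c y ^ 2 + v (s, y) ^ 2) := by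
        rw [hsum]
        refine integral_mono_ae hInt
          ((((integrable_const _).add hWsq).add hv.integrable_sq).const_mul A) ?_
        filter_upwards [ae_restrict_mem measurableSet_Icc, hwW] with y hy hwy
        have hle : |w y| ≤ |sinePoly F c y| := by
          rw [hwy, abs_mul, abs_of_nonneg hθ.1]
          exact mul_le_of_le_one_left (abs_nonneg _) hθ.2
        rw [← hwy]
        exact energy_density_le ((hc.g_osc s hs y hy (w y)).trans (by gcongr))
          ((hc.f_growth s hs y hy (w y)).trans (by gcongr)) (hc.σ_bdd s hs y hy (w y))
    _ = A * (∑ n ∈ F, c n ^ 2 + (1 + ∫ y in Icc (0 : ℝ) 1, v (s, y) ^ 2)) := by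
        rw [integral_const_mul, integral_add (by exact (integrable_const _).add hWsq)
          hv.integrable_sq, integral_add (integrable_const _) hWsq, integral_sq_sinePoly]
        simp [add_left_comm, add_assoc]
    _ ≤ A * (∑ n ∈ F, c n ^ 2 + controlNorm v s ^ 2) :=
        mul_le_mul_of_nonneg_left (add_le_add_right (one_add_integral_sq_le_controlNorm_sq v s) _)
          (by positivity)

theorem isMildNonlinearity (hc : IsSkeletonCoefficients T f g σ K L M) (v : L2TI T) :
    IsMildNonlinearity sineBasis sineFreq T (controlNorm v) (skeletonCoeff f g σ v)
      (√2 * (3 * K + M + L)) (2 * K ^ 2 + 2 * K + 1 + M ^ 2) := by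
  have hK := hc.K_nonneg
  have hL := hc.L_nonneg
  have hM := hc.M_nonneg
  have hV (s : ℝ) : 0 ≤ controlNorm v s := zero_le_one.trans (one_le_controlNorm v s)
  have hweight (n : ℕ) (s : ℝ) : 0 ≤ sineFreq n + controlNorm v s :=
    add_nonneg (sineFreq_pos n).le (hV s)
  have hae : ∀ᵐ s ∂(volume.restrict (Ioc (0 : ℝ) T)), s ∈ Icc 0 T ∧
      MemLp (fun y => v (s, y)) 2 (volume.restrict (Icc (0 : ℝ) 1)) := by
    filter_upwards [ae_memLp_section_L2TI v, ae_restrict_mem measurableSet_Ioc] with s hs hs'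
    exact ⟨Ioc_subset_Icc_self hs', hs⟩
  refine ⟨sineFreq_pos, summable_inv_sineFreq_sq, memLp_controlNorm v, hV, by positivity,
    by positivity, fun n u hu => hc.aestronglyMeasurable_skeletonCoeff n hu _, ?_, ?_, ?_⟩
  · filter_upwards [hae] with s hs n
    refine (hc.abs_skeletonCoeff_zero_le hs.1 hs.2 n).trans ?_
    exact mul_le_mul_of_nonneg_right
      (mul_le_mul_of_nonneg_left (by linarith) (Real.sqrt_nonneg 2)) (hweight n s)
  · filter_upwards [hae] with s hs n w z
    refine (hc.abs_skeletonCoeff_sub_le hs.1 hs.2 n w z).trans ?_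
    have := hweight n s
    gcongr
    linarith
  · filter_upwards [hae] with s hs F c θ hθ
    exact hc.sum_mul_skeletonCoeff_sub_le hs.1 hs.2 F c hθ

end IsSkeletonCoefficients

section SineSeries

/-- The sum of the sine series with coefficients `b`. -/
noncomputable def sineSeries (b : ℕ → ℝ) (x : ℝ) : ℝ := ∑' n, b n * sineFun n x

theorem norm_mul_sineFun_le (r : ℝ) (n : ℕ) (x : ℝ) : ‖r * sineFun n x‖ ≤ |r| * √2 := by
  rw [norm_mul, Real.norm_eq_abs, Real.norm_eq_abs]
  exact mul_le_mul_of_nonneg_left (abs_sineFun_le n x) (abs_nonneg r)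

variable {b : ℕ → ℝ}

theorem hasSum_sineSeries (hb : Summable fun n => |b n|) (x : ℝ) :
    HasSum (fun n => b n * sineFun n x) (sineSeries b x) :=
  (Summable.of_norm_bounded (hb.mul_right _) fun n => norm_mul_sineFun_le (b n) n x).hasSum

theorem continuous_sineSeries (hb : Summable fun n => |b n|) : Continuous (sineSeries b) :=
  continuous_tsum (fun n => continuous_const.mul (continuous_sineFun n)) (hb.mul_right _)
    fun n => norm_mul_sineFun_le (b n) n

theorem integral_sineSeries_mul (hb : Summable fun n => |b n|) {q : ℝ → ℝ}
    (hq : IntegrableOn q (Icc 0 1)) :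
    ∫ x in Icc (0 : ℝ) 1, sineSeries b x * q x =
      ∑' n, b n * ∫ x in Icc (0 : ℝ) 1, q x * sineFun n x := by
  have hsum := hasSum_integral_of_dominated_convergence (μ := volume.restrict (Icc (0 : ℝ) 1))
    (F := fun n x => b n * sineFun n x * q x) (f := fun x => sineSeries b x * q x)
    (fun n x => |b n| * √2 * |q x|)
    (fun n => (continuous_const.mul (continuous_sineFun n)).aestronglyMeasurable.mul
      hq.aestronglyMeasurable)
    (fun n => ae_of_all _ fun x => by
      rw [norm_mul]
      exact mul_le_mul_of_nonneg_right (norm_mul_sineFun_le (b n) n x) (norm_nonneg _))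
    (ae_of_all _ fun x => (hb.mul_right _).mul_right _)
    (by simp_rw [tsum_mul_right]; exact hq.abs.const_mul _)
    (ae_of_all _ fun x => (hasSum_sineSeries hb x).mul_right _)
  rw [← hsum.tsum_eq]
  refine tsum_congr fun n => ?_
  simp_rw [← integral_const_mul, mul_assoc, mul_comm (q _)]

theorem integral_sineSeries_mul_sineFun (hb : Summable fun n => |b n|) (m : ℕ) :
    ∫ x in Icc (0 : ℝ) 1, sineSeries b x * sineFun m x = b m := by
  rw [integral_sineSeries_mul hb (continuous_sineFun m).integrableOn_Icc]
  simp_rw [integral_sineFun_mul, mul_ite, mul_one, mul_zero, eq_comm (a := m)]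
  exact tsum_ite_eq m b _

theorem integral_sineSeries_sq (hb : Summable fun n => |b n|) :
    ∫ x in Icc (0 : ℝ) 1, sineSeries b x ^ 2 = ∑' n, b n ^ 2 := by
  simp_rw [sq]
  rw [integral_sineSeries_mul hb (continuous_sineSeries hb).integrableOn_Icc]
  simp_rw [integral_sineSeries_mul_sineFun hb]

theorem integral_abs_sineSeries_le (hb : Summable fun n => |b n|) :
    ∫ x in Icc (0 : ℝ) 1, |sineSeries b x| ≤ √(∑' n, b n ^ 2) := by
  have hL2 : MemLp (sineSeries b) 2 (volume.restrict (Icc (0 : ℝ) 1)) :=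
    (memLp_two_iff_integrable_sq (continuous_sineSeries hb).aestronglyMeasurable).2
      ((continuous_sineSeries hb).pow 2).integrableOn_Icc
  simpa [integral_sineSeries_sq hb] using
    integral_abs_mul_abs_le_sqrt_mul_sqrt (memLp_const (1 : ℝ)) hL2

end SineSeries

section HeatKernel

theorem rpow_le_exp_two_mul {x q : ℝ} (hx : 0 ≤ x) (hq0 : 0 ≤ q) (hq : q ≤ 2) :
    x ^ q ≤ Real.exp (2 * x) := by
  calc x ^ q ≤ (1 + x) ^ q := by gcongr; linarith
    _ ≤ (1 + x) ^ (2 : ℝ) := Real.rpow_le_rpow_of_exponent_le (by linarith) hq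
    _ = (x + 1) ^ 2 := by rw [Real.rpow_two, add_comm]
    _ ≤ Real.exp x ^ 2 := by gcongr; exact Real.add_one_le_exp x
    _ = Real.exp (2 * x) := by rw [← Real.exp_nat_mul, Nat.cast_ofNat]

theorem summable_sineFreq_rpow {q : ℝ} (hq : q < -1) : Summable fun n => sineFreq n ^ q := by
  have hnat : Summable fun n : ℕ => ((n + 1 : ℕ) : ℝ) ^ q :=
    (summable_nat_add_iff 1).2 (Real.summable_nat_rpow.2 hq)
  refine (hnat.mul_right (Real.pi ^ q)).congr fun n => ?_
  rw [sineFreq, Real.mul_rpow (by positivity) Real.pi_pos.le, Nat.cast_add_one]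

theorem summable_sineFreq_mul_exp {τ : ℝ} (hτ : 0 < τ) :
    Summable fun n => sineFreq n * Real.exp (-(sineFreq n ^ 2 * τ)) := by
  refine Summable.of_nonneg_of_le (fun n => ?_) (fun n => ?_)
    (summable_inv_sineFreq_sq.mul_left (2 * (τ ^ 2)⁻¹))
  · exact mul_nonneg (sineFreq_pos n).le (Real.exp_pos _).le
  · have hk0 := sineFreq_pos n
    have hexp : (sineFreq n ^ 2 * τ) ^ 2 / 2 ≤ Real.exp (sineFreq n ^ 2 * τ) := by
      have := Real.quadratic_le_exp_of_nonneg (x := sineFreq n ^ 2 * τ) (by positivity)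
      linarith [show 0 < sineFreq n ^ 2 * τ by positivity]
    calc sineFreq n * Real.exp (-(sineFreq n ^ 2 * τ))
        = sineFreq n * (Real.exp (sineFreq n ^ 2 * τ))⁻¹ := by rw [Real.exp_neg]
      _ ≤ sineFreq n ^ 2 * ((sineFreq n ^ 2 * τ) ^ 2 / 2)⁻¹ := by
          gcongr
          exact le_self_pow₀ (one_le_sineFreq n) two_ne_zero
      _ = _ := by field_simp

/-- `Γ τ x y = ∑ exp (-k_n² τ) β_n(y) e_n(x)` for `τ > 0`, where `β` is of size `k_n ^ j`. This
covers the Green kernel (`j = 0`) and its derivative in `y` (`j = 1`). -/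
structure IsHeatKernel (Γ : ℝ → ℝ → ℝ → ℝ) (β : ℕ → ℝ → ℝ) (j : ℕ) : Prop where
  le_one : j ≤ 1
  continuous : ∀ n, Continuous (β n)
  bound : ∀ n y, |β n y| ≤ √2 * sineFreq n ^ j
  eq_sineSeries : ∀ {τ : ℝ}, 0 < τ → ∀ x y,
    Γ τ x y = sineSeries (fun n => Real.exp (-(sineFreq n ^ 2 * τ)) * β n y) x

theorem isHeatKernel_greenKernel : IsHeatKernel greenKernel sineFun 0 := by
  refine ⟨zero_le_one, continuous_sineFun, fun n y => by simpa using abs_sineFun_le n y,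
    fun {τ} _ x y => tsum_congr fun n => ?_⟩
  simp only [sineFun, sineFreq, mul_pow]
  linear_combination -(Real.exp (-(((n : ℝ) + 1) ^ 2 * Real.pi ^ 2 * τ)) *
    Real.sin (((n : ℝ) + 1) * Real.pi * x) * Real.sin (((n : ℝ) + 1) * Real.pi * y)) *
    Real.mul_self_sqrt zero_le_two

theorem greenKernel_comm (τ x y : ℝ) : greenKernel τ x y = greenKernel τ y x :=
  tsum_congr fun _ => mul_right_comm _ _ _

theorem hasDerivAt_greenKernel {τ : ℝ} (hτ : 0 < τ) (x y : ℝ) :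
    HasDerivAt (greenKernel τ x)
      (sineSeries (fun n => Real.exp (-(sineFreq n ^ 2 * τ)) * sineFunDeriv n y) x) y := by
  rw [funext (isHeatKernel_greenKernel.eq_sineSeries hτ x)]
  refine hasDerivAt_tsum (u := fun n => 2 * (sineFreq n * Real.exp (-(sineFreq n ^ 2 * τ))))
    ((summable_sineFreq_mul_exp hτ).mul_left 2)
    (fun n z => ((hasDerivAt_sineFun n z).const_mul _).mul_const _) (fun n z => ?_) (y₀ := 0) ?_ y
  · calc _ ≤ |Real.exp (-(sineFreq n ^ 2 * τ)) * sineFunDeriv n z| * √2 :=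
          norm_mul_sineFun_le _ n x
      _ ≤ Real.exp (-(sineFreq n ^ 2 * τ)) * (√2 * sineFreq n) * √2 := by
          rw [abs_mul, Real.abs_exp]
          gcongr
          exact abs_sineFunDeriv_le n z
      _ = √2 * √2 * (sineFreq n * Real.exp (-(sineFreq n ^ 2 * τ))) := by ring
      _ = _ := by rw [Real.mul_self_sqrt zero_le_two]
  · simp [sineFun_zero]

theorem isHeatKernel_greenKernelDy : IsHeatKernel greenKernelDy sineFunDeriv 1 :=
  ⟨le_rfl, continuous_sineFunDeriv, fun n y => by simpa using abs_sineFunDeriv_le n y,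
    fun hτ x y => (hasDerivAt_greenKernel hτ x y).deriv⟩

theorem sineFreq_pow_mul_exp_sq_le {τ : ℝ} (hτ : 0 < τ) {j : ℕ} (hj : j ≤ 1) (n : ℕ) :
    (sineFreq n ^ j * Real.exp (-(sineFreq n ^ 2 * τ))) ^ 2 ≤
      τ ^ (-(3 / 4 + j : ℝ)) * sineFreq n ^ (-(3 / 2) : ℝ) := by
  have hk := sineFreq_pos n
  have hj1 : (j : ℝ) ≤ 1 := by exact_mod_cast hj
  calc (sineFreq n ^ j * Real.exp (-(sineFreq n ^ 2 * τ))) ^ 2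
      = sineFreq n ^ (j * 2) * (Real.exp (2 * (sineFreq n ^ 2 * τ)))⁻¹ := by
        rw [mul_pow, ← pow_mul, ← Real.exp_nat_mul, ← Real.exp_neg, Nat.cast_ofNat, mul_neg]
    _ ≤ sineFreq n ^ (j * 2) * ((sineFreq n ^ 2 * τ) ^ (3 / 4 + j : ℝ))⁻¹ := by
        gcongr
        exact rpow_le_exp_two_mul (by positivity) (by positivity) (by linarith)
    _ = τ ^ (-(3 / 4 + j : ℝ)) * sineFreq n ^ (-(3 / 2) : ℝ) := by
        rw [← Real.rpow_neg (by positivity), Real.mul_rpow (by positivity) hτ.le,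
          ← Real.rpow_natCast _ 2, ← Real.rpow_mul hk.le, ← Real.rpow_natCast _ (j * 2),
          ← mul_assoc, ← Real.rpow_add hk, mul_comm]
        congr 2
        push_cast
        ring

namespace IsHeatKernel

variable {Γ : ℝ → ℝ → ℝ → ℝ} {β : ℕ → ℝ → ℝ} {j : ℕ}

theorem abs_coeff_le (hΓ : IsHeatKernel Γ β j) (τ y : ℝ) (n : ℕ) :
    |Real.exp (-(sineFreq n ^ 2 * τ)) * β n y| ≤
      √2 * (sineFreq n ^ j * Real.exp (-(sineFreq n ^ 2 * τ))) := by
  rw [abs_mul, Real.abs_exp, ← mul_assoc, mul_comm]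
  exact mul_le_mul_of_nonneg_right (hΓ.bound n y) (Real.exp_pos _).le

theorem summable_abs_coeff (hΓ : IsHeatKernel Γ β j) {τ : ℝ} (hτ : 0 < τ) (y : ℝ) :
    Summable fun n => |Real.exp (-(sineFreq n ^ 2 * τ)) * β n y| := by
  refine Summable.of_nonneg_of_le (fun n => abs_nonneg _) (fun n => ?_)
    ((summable_sineFreq_mul_exp hτ).mul_left √2)
  refine (hΓ.abs_coeff_le τ y n).trans ?_
  gcongr
  simpa using pow_le_pow_right₀ (one_le_sineFreq n) hΓ.le_one

theorem continuous_left (hΓ : IsHeatKernel Γ β j) {τ : ℝ} (hτ : 0 < τ) (y : ℝ) :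
    Continuous fun x => Γ τ x y := by
  simp_rw [hΓ.eq_sineSeries hτ]
  exact continuous_sineSeries (hΓ.summable_abs_coeff hτ y)

theorem integral_mul_sineFun (hΓ : IsHeatKernel Γ β j) {τ : ℝ} (hτ : 0 < τ) (y : ℝ) (n : ℕ) :
    ∫ x in Icc (0 : ℝ) 1, Γ τ x y * sineFun n x = Real.exp (-(sineFreq n ^ 2 * τ)) * β n y := by
  simp_rw [hΓ.eq_sineSeries hτ]
  exact integral_sineSeries_mul_sineFun (hΓ.summable_abs_coeff hτ y) n

theorem sq_coeff_le (hΓ : IsHeatKernel Γ β j) {τ : ℝ} (hτ : 0 < τ) (y : ℝ) (n : ℕ) :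
    (Real.exp (-(sineFreq n ^ 2 * τ)) * β n y) ^ 2 ≤
      2 * τ ^ (-(3 / 4 + j : ℝ)) * sineFreq n ^ (-(3 / 2) : ℝ) :=
  calc (Real.exp (-(sineFreq n ^ 2 * τ)) * β n y) ^ 2
      ≤ (√2 * (sineFreq n ^ j * Real.exp (-(sineFreq n ^ 2 * τ)))) ^ 2 :=
        sq_le_sq' (neg_le_of_abs_le (hΓ.abs_coeff_le τ y n)) (le_of_abs_le (hΓ.abs_coeff_le τ y n))
    _ = 2 * (sineFreq n ^ j * Real.exp (-(sineFreq n ^ 2 * τ))) ^ 2 := by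
        rw [mul_pow, Real.sq_sqrt zero_le_two]
    _ ≤ 2 * (τ ^ (-(3 / 4 + j : ℝ)) * sineFreq n ^ (-(3 / 2) : ℝ)) := by
        gcongr
        exact sineFreq_pow_mul_exp_sq_le hτ hΓ.le_one n
    _ = _ := (mul_assoc _ _ _).symm

theorem exists_integral_abs_le (hΓ : IsHeatKernel Γ β j) : ∃ Z : ℝ, ∀ τ y, 0 < τ →
    ∫ x in Icc (0 : ℝ) 1, |Γ τ x y| ≤ Z * τ ^ (-(3 / 8 + j / 2 : ℝ)) := by
  refine ⟨√(2 * ∑' n, sineFreq n ^ (-(3 / 2) : ℝ)), fun τ y hτ => ?_⟩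
  have hsum := (summable_sineFreq_rpow (q := -(3 / 2)) (by norm_num)).mul_left
    (2 * τ ^ (-(3 / 4 + j : ℝ)))
  have hsq : √(τ ^ (-(3 / 4 + j : ℝ))) = τ ^ (-(3 / 8 + j / 2 : ℝ)) := by
    rw [Real.sqrt_eq_rpow, ← Real.rpow_mul hτ.le]
    ring_nf
  simp_rw [hΓ.eq_sineSeries hτ]
  calc _ ≤ √(∑' n, (Real.exp (-(sineFreq n ^ 2 * τ)) * β n y) ^ 2) :=
        integral_abs_sineSeries_le (hΓ.summable_abs_coeff hτ y)
    _ ≤ √(∑' n, 2 * τ ^ (-(3 / 4 + j : ℝ)) * sineFreq n ^ (-(3 / 2) : ℝ)) :=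
        Real.sqrt_le_sqrt ((hsum.of_nonneg_of_le (fun n => sq_nonneg _)
          (hΓ.sq_coeff_le hτ y)).tsum_le_tsum (hΓ.sq_coeff_le hτ y) hsum)
    _ = _ := by
        rw [tsum_mul_left, mul_right_comm, Real.sqrt_mul' _ (by positivity), hsq]

end IsHeatKernel

end HeatKernel

section HeatConvolution

/-- Lebesgue measure on `(0,t) × [0,1]`. -/
noncomputable abbrev spaceTimeMeasure (t : ℝ) : Measure (ℝ × ℝ) :=
  (volume.restrict (Ioo (0 : ℝ) t)).prod (volume.restrict (Icc (0 : ℝ) 1))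

theorem ae_spaceTimeMeasure_fst_mem (t : ℝ) : ∀ᵐ z ∂(spaceTimeMeasure t), z.1 ∈ Ioo 0 t :=
  Measure.quasiMeasurePreserving_fst.ae (ae_restrict_mem measurableSet_Ioo)

theorem iterIntegrable_and_iterInt_eq {F : ℝ → ℝ → ℝ} {Φ : ℝ × ℝ → ℝ} {t : ℝ}
    (hΦ : Integrable Φ (spaceTimeMeasure t))
    (h : ∀ s ∈ Ioo 0 t, F s =ᵐ[volume.restrict (Icc (0 : ℝ) 1)] fun y => Φ (s, y)) :
    IterIntegrable F t ∧ iterInt F t = ∫ z, Φ z ∂(spaceTimeMeasure t) := by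
  have hsection : ∀ᵐ s ∂(volume.restrict (Ioo (0 : ℝ) t)),
      (fun y => Φ (s, y)) =ᵐ[volume.restrict (Icc (0 : ℝ) 1)] F s := by
    filter_upwards [ae_restrict_mem measurableSet_Ioo] with s hs
    exact (h s hs).symm
  have hInt := hsection.mono fun s hs => integral_congr_ae hs
  refine ⟨⟨?_, hΦ.integral_prod_left.congr hInt, hΦ.abs.integral_prod_left.congr ?_⟩, ?_⟩
  · filter_upwards [hΦ.prod_right_ae, hsection] with s hs hs' using hs.congr hs'
  · exact hsection.mono fun s hs => integral_congr_ae (hs.fun_comp abs)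
  · rw [integral_prod _ hΦ, iterInt]
    exact (integral_congr_ae hInt).symm

theorem integrableOn_sub_rpow {t r : ℝ} (hr : -1 < r) :
    IntegrableOn (fun s => (t - s) ^ r) (Ioo 0 t) := by
  rcases le_or_gt t 0 with ht | ht
  · simp [Ioo_eq_empty (not_lt.2 ht)]
  · have h := (intervalIntegral.intervalIntegrable_rpow' (a := t) (b := 0) hr).comp_sub_left t
    simp only [sub_self, sub_zero] at h
    exact (intervalIntegrable_iff_integrableOn_Ioo_of_le ht.le).1 h

theorem memLp_sub_rpow {t r : ℝ} (hr : -1 < 2 * r) :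
    MemLp (fun s => (t - s) ^ r) 2 (volume.restrict (Ioo 0 t)) := by
  rw [memLp_two_iff_integrable_sq (by fun_prop : Measurable _).aestronglyMeasurable]
  refine (integrableOn_sub_rpow hr).congr ?_
  filter_upwards [ae_restrict_mem measurableSet_Ioo] with s hs
  rw [← Real.rpow_natCast, ← Real.rpow_mul (sub_pos.2 hs.2).le, mul_comm, Nat.cast_ofNat]

/-- `φ` is a jointly measurable version of the time sections of `F`, and
`∫∫ (t - s) ^ (-(3/8 + j/2)) |φ(s,y)|` is finite. The weight bounds the `L¹` norm in `x` of a heat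
kernel with parameter `j`, so the convolution of such a kernel with `F` converges absolutely. -/
structure IsHeatSource (j : ℕ) (F : ℝ → ℝ → ℝ) (φ : ℝ × ℝ → ℝ) (t : ℝ) : Prop where
  measurable : Measurable φ
  ae_eq : ∀ s, F s =ᵐ[volume.restrict (Icc (0 : ℝ) 1)] fun y => φ (s, y)
  integrable : Integrable (fun z => (t - z.1) ^ (-(3 / 8 + j / 2 : ℝ)) * |φ z|) (spaceTimeMeasure t)

theorem IsHeatSource.of_integral_abs_le {j : ℕ} {F : ℝ → ℝ → ℝ} {t : ℝ} {φ : ℝ × ℝ → ℝ}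
    (hφ : Measurable φ) (hF : ∀ s, F s =ᵐ[volume.restrict (Icc (0 : ℝ) 1)] fun y => φ (s, y))
    {m : ℝ → ℝ} (hm : IntegrableOn (fun s => (t - s) ^ (-(3 / 8 + j / 2 : ℝ)) * m s) (Ioo 0 t))
    (hbound : ∀ᵐ s ∂(volume.restrict (Ioo (0 : ℝ) t)),
      IntegrableOn (F s) (Icc 0 1) ∧ ∫ y in Icc (0 : ℝ) 1, |F s y| ≤ m s) :
    IsHeatSource j F φ t := by
  refine ⟨hφ, hF, ?_⟩
  have hmeas : Measurable fun z : ℝ × ℝ => (t - z.1) ^ (-(3 / 8 + j / 2 : ℝ)) * |φ z| :=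
    Measurable.mul (by fun_prop) hφ.abs
  rw [integrable_prod_iff hmeas.aestronglyMeasurable]
  refine ⟨?_, hm.mono' hmeas.norm.stronglyMeasurable.integral_prod_right'.aestronglyMeasurable ?_⟩
  · filter_upwards [hbound] with s hs
    exact (hs.1.congr (hF s)).abs.const_mul _
  · filter_upwards [hbound, ae_restrict_mem measurableSet_Ioo] with s hs hst
    have hweight : 0 ≤ (t - s) ^ (-(3 / 8 + j / 2 : ℝ)) := Real.rpow_nonneg (sub_pos.2 hst.2).le _
    have habs : ∫ y in Icc (0 : ℝ) 1, |F s y| = ∫ y in Icc (0 : ℝ) 1, |φ (s, y)| :=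
      integral_congr_ae ((hF s).fun_comp abs)
    rw [Real.norm_eq_abs, abs_of_nonneg (integral_nonneg fun y => norm_nonneg _)]
    simp_rw [norm_mul, Real.norm_eq_abs, abs_abs, abs_of_nonneg hweight]
    rw [integral_const_mul, ← habs]
    exact mul_le_mul_of_nonneg_left hs.2 hweight

namespace IsHeatKernel

variable {Γ : ℝ → ℝ → ℝ → ℝ} {β : ℕ → ℝ → ℝ} {j : ℕ} {F : ℝ → ℝ → ℝ} {φ : ℝ × ℝ → ℝ} {t : ℝ}

theorem aestronglyMeasurable (hΓ : IsHeatKernel Γ β j) (t : ℝ) :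
    AEStronglyMeasurable (fun p : (ℝ × ℝ) × ℝ => Γ (t - p.1.1) p.2 p.1.2)
      ((spaceTimeMeasure t).prod (volume.restrict (Icc (0 : ℝ) 1))) := by
  have hβ := fun n => (hΓ.continuous n).measurable
  have he := fun n => (continuous_sineFun n).measurable
  refine aestronglyMeasurable_of_tendsto_ae atTop (f := fun N (p : (ℝ × ℝ) × ℝ) =>
    ∑ n ∈ Finset.range N, Real.exp (-(sineFreq n ^ 2 * (t - p.1.1))) * β n p.1.2 * sineFun n p.2)
    (fun N => (by fun_prop : Measurable _).aestronglyMeasurable) ?_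
  filter_upwards [Measure.quasiMeasurePreserving_fst.ae (ae_spaceTimeMeasure_fst_mem t)] with p hp
  have hτ := sub_pos.2 hp.2
  rw [hΓ.eq_sineSeries hτ]
  exact (hasSum_sineSeries (hΓ.summable_abs_coeff hτ p.1.2) p.2).tendsto_sum_nat

theorem integrable_mul (hΓ : IsHeatKernel Γ β j) (hF : IsHeatSource j F φ t) :
    Integrable (fun p : (ℝ × ℝ) × ℝ => Γ (t - p.1.1) p.2 p.1.2 * φ p.1)
      ((spaceTimeMeasure t).prod (volume.restrict (Icc (0 : ℝ) 1))) := by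
  obtain ⟨Z, hZ⟩ := hΓ.exists_integral_abs_le
  have hmeas : AEStronglyMeasurable (fun p : (ℝ × ℝ) × ℝ => Γ (t - p.1.1) p.2 p.1.2 * φ p.1)
      ((spaceTimeMeasure t).prod (volume.restrict (Icc (0 : ℝ) 1))) :=
    (hΓ.aestronglyMeasurable t).mul (hF.measurable.comp measurable_fst).aestronglyMeasurable
  rw [integrable_prod_iff hmeas]
  refine ⟨?_, (hF.integrable.const_mul Z).mono' hmeas.norm.integral_prod_right' ?_⟩
  · filter_upwards [ae_spaceTimeMeasure_fst_mem t] with z hz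
    exact (hΓ.continuous_left (sub_pos.2 hz.2) z.2).integrableOn_Icc.integrable.mul_const (φ z)
  · filter_upwards [ae_spaceTimeMeasure_fst_mem t] with z hz
    rw [Real.norm_eq_abs, abs_of_nonneg (integral_nonneg fun y => norm_nonneg _)]
    simp_rw [norm_mul, Real.norm_eq_abs]
    rw [integral_mul_const, ← mul_assoc]
    exact mul_le_mul_of_nonneg_right (hZ _ _ (sub_pos.2 hz.2)) (abs_nonneg _)

theorem ae_iterIntegrable_and_iterInt_eq (hΓ : IsHeatKernel Γ β j) (hF : IsHeatSource j F φ t) :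
    ∀ᵐ x ∂(volume.restrict (Icc (0 : ℝ) 1)),
      IterIntegrable (fun s y => Γ (t - s) x y * F s y) t ∧
      iterInt (fun s y => Γ (t - s) x y * F s y) t =
        ∫ z, Γ (t - z.1) x z.2 * φ z ∂(spaceTimeMeasure t) := by
  filter_upwards [(hΓ.integrable_mul hF).prod_left_ae] with x hx
  exact iterIntegrable_and_iterInt_eq hx fun s _ => (hF.ae_eq s).mono fun y hy => by simp only [hy]

theorem integrableOn_iterInt (hΓ : IsHeatKernel Γ β j) (hF : IsHeatSource j F φ t) :
    IntegrableOn (fun x => iterInt (fun s y => Γ (t - s) x y * F s y) t) (Icc 0 1) :=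
  (hΓ.integrable_mul hF).integral_prod_right.congr
    ((hΓ.ae_iterIntegrable_and_iterInt_eq hF).mono fun _ hx => hx.2.symm)

theorem integrable_mul_mul_sineFun (hΓ : IsHeatKernel Γ β j) (hF : IsHeatSource j F φ t) (n : ℕ) :
    Integrable (fun p : (ℝ × ℝ) × ℝ => Γ (t - p.1.1) p.2 p.1.2 * φ p.1 * sineFun n p.2)
      ((spaceTimeMeasure t).prod (volume.restrict (Icc (0 : ℝ) 1))) :=
  (hΓ.integrable_mul hF).mul_bdd (c := √2)
    ((continuous_sineFun n).comp continuous_snd).aestronglyMeasurable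
    (ae_of_all _ fun p => abs_sineFun_le n p.2)

theorem ae_integral_mul_mul_sineFun (hΓ : IsHeatKernel Γ β j) (φ : ℝ × ℝ → ℝ) (t : ℝ) (n : ℕ) :
    (fun z => ∫ x in Icc (0 : ℝ) 1, Γ (t - z.1) x z.2 * φ z * sineFun n x)
      =ᵐ[spaceTimeMeasure t]
        fun z => Real.exp (-(sineFreq n ^ 2 * (t - z.1))) * (φ z * β n z.2) := by
  filter_upwards [ae_spaceTimeMeasure_fst_mem t] with z hz
  simp_rw [mul_right_comm _ (φ z)]
  rw [integral_mul_const, hΓ.integral_mul_sineFun (sub_pos.2 hz.2), mul_right_comm, mul_assoc]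

theorem integrable_exp_mul (hΓ : IsHeatKernel Γ β j) (hF : IsHeatSource j F φ t) (n : ℕ) :
    Integrable (fun z : ℝ × ℝ => Real.exp (-(sineFreq n ^ 2 * (t - z.1))) * (φ z * β n z.2))
      (spaceTimeMeasure t) :=
  (hΓ.integrable_mul_mul_sineFun hF n).integral_prod_left.congr
    (hΓ.ae_integral_mul_mul_sineFun φ t n)

theorem intervalIntegrable_integral_mul (hΓ : IsHeatKernel Γ β j) (hF : IsHeatSource j F φ t)
    (ht : 0 ≤ t) (n : ℕ) :
    IntervalIntegrable (fun s => ∫ y in Icc (0 : ℝ) 1, F s y * β n y) volume 0 t := by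
  have hexp : IntervalIntegrable (fun s => ∫ y in Icc (0 : ℝ) 1,
      Real.exp (-(sineFreq n ^ 2 * (t - s))) * (φ (s, y) * β n y)) volume 0 t :=
    (intervalIntegrable_iff_integrableOn_Ioo_of_le ht).2
      (hΓ.integrable_exp_mul hF n).integral_prod_left
  refine (hexp.continuousOn_mul (g := fun s => Real.exp (sineFreq n ^ 2 * (t - s)))
    (by fun_prop)).congr fun s _ => ?_
  have hsection : ∫ y in Icc (0 : ℝ) 1, F s y * β n y = ∫ y in Icc (0 : ℝ) 1, φ (s, y) * β n y :=
    integral_congr_ae ((hF.ae_eq s).mono fun y hy => congrArg (· * β n y) hy)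
  rw [integral_const_mul, hsection, ← mul_assoc, ← Real.exp_add, add_neg_cancel, Real.exp_zero,
    one_mul]

theorem integral_iterInt_mul_sineFun (hΓ : IsHeatKernel Γ β j) (hF : IsHeatSource j F φ t)
    (ht : 0 ≤ t) (n : ℕ) :
    ∫ x in Icc (0 : ℝ) 1, iterInt (fun s y => Γ (t - s) x y * F s y) t * sineFun n x =
      duhamel (sineFreq n ^ 2) 0 (fun s => ∫ y in Icc (0 : ℝ) 1, F s y * β n y) t :=
  calc ∫ x in Icc (0 : ℝ) 1, iterInt (fun s y => Γ (t - s) x y * F s y) t * sineFun n x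
      = ∫ x in Icc (0 : ℝ) 1, ∫ z, Γ (t - z.1) x z.2 * φ z * sineFun n x ∂(spaceTimeMeasure t) := by
        simp_rw [integral_mul_const]
        exact integral_congr_ae ((hΓ.ae_iterIntegrable_and_iterInt_eq hF).mono fun x hx =>
          congrArg (· * sineFun n x) hx.2)
    _ = ∫ z, (∫ x in Icc (0 : ℝ) 1, Γ (t - z.1) x z.2 * φ z * sineFun n x)
          ∂(spaceTimeMeasure t) :=
        (integral_integral_swap (hΓ.integrable_mul_mul_sineFun hF n)).symm
    _ = ∫ z, Real.exp (-(sineFreq n ^ 2 * (t - z.1))) * (φ z * β n z.2) ∂(spaceTimeMeasure t) :=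
        integral_congr_ae (hΓ.ae_integral_mul_mul_sineFun φ t n)
    _ = ∫ s in Ioo 0 t, Real.exp (-(sineFreq n ^ 2 * (t - s))) *
          ∫ y in Icc (0 : ℝ) 1, φ (s, y) * β n y := by
        rw [integral_prod _ (hΓ.integrable_exp_mul hF n)]
        simp_rw [integral_const_mul]
    _ = ∫ s in Ioo 0 t, Real.exp (-(sineFreq n ^ 2 * (t - s))) *
          ∫ y in Icc (0 : ℝ) 1, F s y * β n y := by
        refine integral_congr_ae (ae_of_all _ fun s => congrArg _ (integral_congr_ae ?_))
        exact (hF.ae_eq s).mono fun y hy => congrArg (· * β n y) hy.symm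
    _ = _ := by
        rw [duhamel, mul_zero, zero_add, intervalIntegral.integral_of_le ht,
          integral_Ioc_eq_integral_Ioo]

end IsHeatKernel

theorem summable_exp_mul_inner_sineBasis {t : ℝ} (ht : 0 < t) (η : L2I) :
    Summable fun n => |Real.exp (-(sineFreq n ^ 2 * t)) * inner ℝ (sineBasis n) η| := by
  refine Summable.of_nonneg_of_le (fun n => abs_nonneg _) (fun n => ?_)
    ((summable_sineFreq_mul_exp ht).mul_right ‖η‖)
  have hinner : |inner ℝ (sineBasis n) η| ≤ ‖η‖ := by
    simpa [sineBasis.orthonormal.1 n] using abs_real_inner_le_norm (sineBasis n) η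
  rw [abs_mul, Real.abs_exp]
  exact mul_le_mul (le_mul_of_one_le_left (Real.exp_pos _).le (one_le_sineFreq n)) hinner
    (abs_nonneg _) (mul_nonneg (sineFreq_pos n).le (Real.exp_pos _).le)

theorem integral_greenKernel_mul {t : ℝ} (ht : 0 < t) (η : L2I) (x : ℝ) :
    ∫ y in Icc (0 : ℝ) 1, greenKernel t x y * η y =
      sineSeries (fun n => Real.exp (-(sineFreq n ^ 2 * t)) * inner ℝ (sineBasis n) η) x := by
  simp_rw [greenKernel_comm t x, isHeatKernel_greenKernel.eq_sineSeries ht]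
  rw [integral_sineSeries_mul (isHeatKernel_greenKernel.summable_abs_coeff ht x)
    (integrableOn_coeFn_L2I η)]
  exact tsum_congr fun n => by simp only [inner_sineBasis, mul_right_comm]

end HeatConvolution

section RightHandSide

/-- The right-hand side of the skeleton equation for the path `u`. -/
noncomputable def skeletonRHS {T : ℝ} (f g σ : ℝ → ℝ → ℝ → ℝ) (η : L2I) (v : L2TI T) (u : ℝ → L2I)
    (t x : ℝ) : ℝ :=
  (∫ y in Icc (0 : ℝ) 1, greenKernel t x y * η y)
    - iterInt (fun s y => greenKernelDy (t - s) x y * g s y (u s y)) t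
    + iterInt (fun s y => greenKernel (t - s) x y * f s y (u s y)) t
    + iterInt (fun s y => greenKernel (t - s) x y * (σ s y (u s y) * v (s, y))) t

theorem integrableOn_mul_sineFun {p : ℝ → ℝ} (hp : IntegrableOn p (Icc 0 1)) (n : ℕ) :
    IntegrableOn (fun x => p x * sineFun n x) (Icc 0 1) :=
  hp.mul_continuousOn (continuous_sineFun n).continuousOn isCompact_Icc

theorem integrableOn_integral_greenKernel_mul {t : ℝ} (ht : 0 < t) (η : L2I) :
    IntegrableOn (fun x => ∫ y in Icc (0 : ℝ) 1, greenKernel t x y * η y) (Icc 0 1) := by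
  simp_rw [integral_greenKernel_mul ht]
  exact (continuous_sineSeries (summable_exp_mul_inner_sineBasis ht η)).integrableOn_Icc

namespace IsSkeletonCoefficients

variable {T : ℝ} {v : L2TI T} {f g σ : ℝ → ℝ → ℝ → ℝ} {K L M : ℝ} {u : ℝ → L2I}
  {φ : ℝ × ℝ → ℝ} {R t : ℝ}

theorem isHeatSource_g (hc : IsSkeletonCoefficients T f g σ K L M) (hφ : Measurable φ)
    (hu : ∀ s, u s =ᵐ[volume.restrict (Icc (0 : ℝ) 1)] fun y => φ (s, y)) (hR : ∀ s, ‖u s‖ ≤ R)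
    (ht : t ≤ T) :
    IsHeatSource 1 (fun s y => g s y (u s y)) (fun z => g z.1 z.2 (φ z)) t := by
  have hK := hc.K_nonneg
  refine .of_integral_abs_le (m := fun _ => 3 * K * (1 + R ^ 2))
    (hc.measurable_g.comp (measurable_fst.prodMk (measurable_snd.prodMk hφ)))
    (fun s => (hu s).mono fun y hy => congrArg (g s y) hy)
    ((integrableOn_sub_rpow (by norm_num)).mul_const _) ?_
  filter_upwards [ae_restrict_mem measurableSet_Ioo] with s hs
  have hsT : s ∈ Icc 0 T := ⟨hs.1.le, hs.2.le.trans ht⟩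
  refine ⟨hc.integrableOn_g hsT (u s), (hc.integral_abs_g_le hsT (u s)).trans ?_⟩
  gcongr
  exact hR s

theorem isHeatSource_f (hc : IsSkeletonCoefficients T f g σ K L M) (hφ : Measurable φ)
    (hu : ∀ s, u s =ᵐ[volume.restrict (Icc (0 : ℝ) 1)] fun y => φ (s, y)) (hR : ∀ s, ‖u s‖ ≤ R)
    (ht : t ≤ T) :
    IsHeatSource 0 (fun s y => f s y (u s y)) (fun z => f z.1 z.2 (φ z)) t := by
  have hK := hc.K_nonneg
  refine .of_integral_abs_le (m := fun _ => K * (1 + R))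
    (hc.measurable_f.comp (measurable_fst.prodMk (measurable_snd.prodMk hφ)))
    (fun s => (hu s).mono fun y hy => congrArg (f s y) hy)
    ((integrableOn_sub_rpow (by norm_num)).mul_const _) ?_
  filter_upwards [ae_restrict_mem measurableSet_Ioo] with s hs
  have hsT : s ∈ Icc 0 T := ⟨hs.1.le, hs.2.le.trans ht⟩
  refine ⟨hc.integrableOn_f hsT (u s), (hc.integral_abs_f_le hsT (u s)).trans ?_⟩
  gcongr
  exact hR s

theorem isHeatSource_σ_mul (hc : IsSkeletonCoefficients T f g σ K L M) (v : L2TI T)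
    (hφ : Measurable φ) (hu : ∀ s, u s =ᵐ[volume.restrict (Icc (0 : ℝ) 1)] fun y => φ (s, y))
    (ht : t ≤ T) :
    IsHeatSource 0 (fun s y => σ s y (u s y) * v (s, y)) (fun z => σ z.1 z.2 (φ z) * v z) t := by
  have hsub : Ioo 0 t ⊆ Ioc 0 T := fun s hs => ⟨hs.1, hs.2.le.trans ht⟩
  refine .of_integral_abs_le (m := fun s => M * controlNorm v s)
    ((hc.measurable_σ.comp (measurable_fst.prodMk (measurable_snd.prodMk hφ))).mul
      (measurable_coeFn_L2TI v))
    (fun s => (hu s).mono fun y hy => congrArg (fun r => σ s y r * v (s, y)) hy)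
    ((memLp_sub_rpow (by norm_num)).integrable_mul
      (((memLp_controlNorm v).mono_measure (Measure.restrict_mono_set _ hsub)).const_mul M)) ?_
  filter_upwards [ae_mono (Measure.restrict_mono_set _ hsub) (ae_memLp_section_L2TI v),
    ae_restrict_mem measurableSet_Ioo] with s hv hs
  have hsT : s ∈ Icc 0 T := Ioc_subset_Icc_self (hsub hs)
  exact ⟨hc.integrableOn_σ_mul hsT hv (u s), hc.integral_abs_σ_mul_le hsT hv (u s)⟩

theorem ae_iterIntegrable (hc : IsSkeletonCoefficients T f g σ K L M) (v : L2TI T)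
    (hu : Continuous u) (hR : ∀ s, ‖u s‖ ≤ R) (ht : t ≤ T) :
    ∀ᵐ x ∂(volume.restrict (Icc (0 : ℝ) 1)),
      IterIntegrable (fun s y => greenKernelDy (t - s) x y * g s y (u s y)) t ∧
      IterIntegrable (fun s y => greenKernel (t - s) x y * f s y (u s y)) t ∧
      IterIntegrable (fun s y => greenKernel (t - s) x y * (σ s y (u s y) * v (s, y))) t := by
  obtain ⟨φ, hφ, hφu⟩ := exists_measurable_version hu
  filter_upwards [
    isHeatKernel_greenKernelDy.ae_iterIntegrable_and_iterInt_eq (hc.isHeatSource_g hφ hφu hR ht),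
    isHeatKernel_greenKernel.ae_iterIntegrable_and_iterInt_eq (hc.isHeatSource_f hφ hφu hR ht),
    isHeatKernel_greenKernel.ae_iterIntegrable_and_iterInt_eq (hc.isHeatSource_σ_mul v hφ hφu ht)]
    with x hxg hxf hxσ
  exact ⟨hxg.1, hxf.1, hxσ.1⟩

theorem integrableOn_skeletonRHS (hc : IsSkeletonCoefficients T f g σ K L M) (η : L2I) (v : L2TI T)
    (hu : Continuous u) (hR : ∀ s, ‖u s‖ ≤ R) (ht : 0 < t) (htT : t ≤ T) :
    IntegrableOn (skeletonRHS f g σ η v u t) (Icc 0 1) := by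
  obtain ⟨φ, hφ, hφu⟩ := exists_measurable_version hu
  unfold skeletonRHS
  exact (((integrableOn_integral_greenKernel_mul ht η).sub
    (isHeatKernel_greenKernelDy.integrableOn_iterInt (hc.isHeatSource_g hφ hφu hR htT))).add
    (isHeatKernel_greenKernel.integrableOn_iterInt (hc.isHeatSource_f hφ hφu hR htT))).add
    (isHeatKernel_greenKernel.integrableOn_iterInt (hc.isHeatSource_σ_mul v hφ hφu htT))

theorem integral_skeletonRHS_mul_sineFun (hc : IsSkeletonCoefficients T f g σ K L M) (η : L2I)
    (v : L2TI T) (hu : Continuous u) (hR : ∀ s, ‖u s‖ ≤ R) (ht : 0 < t) (htT : t ≤ T) (n : ℕ) :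
    ∫ x in Icc (0 : ℝ) 1, skeletonRHS f g σ η v u t x * sineFun n x =
      mildCoord sineBasis sineFreq (skeletonCoeff f g σ v) η u n t := by
  obtain ⟨φ, hφ, hφu⟩ := exists_measurable_version hu
  have hG := isHeatKernel_greenKernel
  have hGy := isHeatKernel_greenKernelDy
  have hg := hc.isHeatSource_g hφ hφu hR htT
  have hf := hc.isHeatSource_f hφ hφu hR htT
  have hσ := hc.isHeatSource_σ_mul v hφ hφu htT
  have hη := integrableOn_mul_sineFun (integrableOn_integral_greenKernel_mul ht η) n
  have hg' := integrableOn_mul_sineFun (hGy.integrableOn_iterInt hg) n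
  have hf' := integrableOn_mul_sineFun (hG.integrableOn_iterInt hf) n
  have hσ' := integrableOn_mul_sineFun (hG.integrableOn_iterInt hσ) n
  simp only [skeletonRHS, add_mul, sub_mul]
  rw [integral_add (by exact (hη.sub hg').add hf') hσ', integral_add (by exact hη.sub hg') hf',
    integral_sub hη hg', hGy.integral_iterInt_mul_sineFun hg ht.le,
    hG.integral_iterInt_mul_sineFun hf ht.le, hG.integral_iterInt_mul_sineFun hσ ht.le]
  simp_rw [integral_greenKernel_mul ht]
  rw [integral_sineSeries_mul_sineFun (summable_exp_mul_inner_sineBasis ht η)]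
  exact (duhamel_neg_add_add (hGy.intervalIntegrable_integral_mul hg ht.le n)
    (hG.intervalIntegrable_integral_mul hf ht.le n)
    (hG.intervalIntegrable_integral_mul hσ ht.le n)).symm

theorem isSkeletonSolution_iff (hc : IsSkeletonCoefficients T f g σ K L M) (hT : 0 ≤ T) (η : L2I)
    (v : L2TI T) (h : C(Icc (0 : ℝ) T, L2I)) :
    IsSkeletonSolution hT f g σ η v h ↔ ∀ t n, inner ℝ (sineBasis n) (h t) =
      mildCoord sineBasis sineFreq (skeletonCoeff f g σ v) η (IccExtend hT h) n t := by
  have hu : Continuous (IccExtend hT h) := h.continuous.Icc_extend'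
  have hR (s : ℝ) : ‖IccExtend hT h s‖ ≤ ‖h‖ := h.norm_coe_le_norm _
  have hzero (n : ℕ) : mildCoord sineBasis sineFreq (skeletonCoeff f g σ v) η (IccExtend hT h) n 0 =
      inner ℝ (sineBasis n) η := duhamel_zero_right _ _ _
  have hRHS {t : Icc (0 : ℝ) T} (ht : 0 < (t : ℝ)) :=
    hc.integral_skeletonRHS_mul_sineFun η v hu hR ht t.2.2
  constructor
  · rintro ⟨h0, hsol⟩ t n
    rcases t.2.1.eq_or_lt with ht | ht
    · obtain rfl : t = ⟨0, left_mem_Icc.2 hT⟩ := Subtype.ext ht.symm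
      rw [h0, hzero]
    · rw [← hRHS ht n, inner_sineBasis]
      exact integral_congr_ae ((hsol t ht).mono fun x hx => congrArg (· * sineFun n x) hx.2.2.2)
  · intro hm
    refine ⟨eq_of_inner_basis_eq sineBasis fun n => by rw [hm, hzero], fun t ht => ?_⟩
    have hi := hc.integrableOn_skeletonRHS η v hu hR ht t.2.2
    have heq := ae_eq_zero_of_integral_mul_sineFun_eq_zero ((integrableOn_coeFn_L2I (h t)).sub hi)
      fun n => by
        simp only [Pi.sub_apply, sub_mul]
        rw [integral_sub (integrableOn_mul_sineFun (integrableOn_coeFn_L2I (h t)) n)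
          (integrableOn_mul_sineFun hi n), hRHS ht, ← inner_sineBasis, hm, sub_self]
    filter_upwards [hc.ae_iterIntegrable v hu hR t.2.2, heq] with x hx hx'
    exact ⟨hx.1, hx.2.1, hx.2.2, sub_eq_zero.1 hx'⟩

theorem existsUnique_isSkeletonSolution (hc : IsSkeletonCoefficients T f g σ K L M) (hT : 0 ≤ T)
    (η : L2I) (v : L2TI T) :
    ∃! h : C(Icc (0 : ℝ) T, L2I), IsSkeletonSolution hT f g σ η v h := by
  simp_rw [hc.isSkeletonSolution_iff hT η v]
  exact (hc.isMildNonlinearity v).existsUnique_mild hT η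

theorem of_decomposition {g₁ : ℝ → ℝ → ℝ → ℝ} {g₂ : ℝ → ℝ → ℝ} (hT : 0 ≤ T)
    (hf : Measurable fun p : ℝ × ℝ × ℝ => f p.1 p.2.1 p.2.2)
    (hg : Measurable fun p : ℝ × ℝ × ℝ => g p.1 p.2.1 p.2.2)
    (hσ : Measurable fun p : ℝ × ℝ × ℝ => σ p.1 p.2.1 p.2.2)
    (hf_growth : ∀ t ∈ Icc 0 T, ∀ x ∈ Icc (0 : ℝ) 1, ∀ r, |f t x r| ≤ K * (1 + |r|))
    (hg_decomp : ∀ t ∈ Icc 0 T, ∀ x ∈ Icc (0 : ℝ) 1, ∀ r, g t x r = g₁ t x r + g₂ t r)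
    (hg₁_growth : ∀ t ∈ Icc 0 T, ∀ x ∈ Icc (0 : ℝ) 1, ∀ r, |g₁ t x r| ≤ K * (1 + |r|))
    (hg₂_growth : ∀ t ∈ Icc 0 T, ∀ r, |g₂ t r| ≤ K * (1 + |r| ^ 2))
    (hσ_bdd : ∀ t ∈ Icc 0 T, ∀ x ∈ Icc (0 : ℝ) 1, ∀ r, |σ t x r| ≤ M)
    (hσ_lip : ∀ t ∈ Icc 0 T, ∀ x ∈ Icc (0 : ℝ) 1, ∀ p q, |σ t x p - σ t x q| ≤ L * |p - q|)
    (hf_lip : ∀ t ∈ Icc 0 T, ∀ x ∈ Icc (0 : ℝ) 1, ∀ p q,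
      |f t x p - f t x q| ≤ L * (1 + |p| + |q|) * |p - q|)
    (hg_lip : ∀ t ∈ Icc 0 T, ∀ x ∈ Icc (0 : ℝ) 1, ∀ p q,
      |g t x p - g t x q| ≤ L * (1 + |p| + |q|) * |p - q|) :
    IsSkeletonCoefficients T f g σ K L M := by
  have h0T : (0 : ℝ) ∈ Icc 0 T := left_mem_Icc.2 hT
  have h0I : (0 : ℝ) ∈ Icc (0 : ℝ) 1 := left_mem_Icc.2 zero_le_one
  have hK : 0 ≤ K := by simpa using (abs_nonneg _).trans (hf_growth 0 h0T 0 h0I 0)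
  have hL : 0 ≤ L := by simpa using (abs_nonneg _).trans (hσ_lip 0 h0T 0 h0I 1 0)
  have hM : 0 ≤ M := (abs_nonneg _).trans (hσ_bdd 0 h0T 0 h0I 0)
  refine ⟨hK, hL, hM, hf, hg, hσ, hf_growth, fun t ht x hx r => ?_, fun t ht x hx r => ?_,
    hσ_bdd, hσ_lip, hf_lip, hg_lip⟩
  · calc |g t x r| ≤ |g₁ t x r| + |g₂ t r| := hg_decomp t ht x hx r ▸ abs_add_le _ _
      _ ≤ K * (1 + |r|) + K * (1 + |r| ^ 2) :=
          add_le_add (hg₁_growth t ht x hx r) (hg₂_growth t ht r)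
      _ = K * (2 + |r| + |r| ^ 2) := by ring
      _ ≤ K * (3 * (1 + |r| ^ 2)) :=
          mul_le_mul_of_nonneg_left (by nlinarith [sq_nonneg (|r| - 1)]) hK
      _ = 3 * K * (1 + r ^ 2) := by rw [sq_abs]; ring
  · calc |g t x r - g t 0 r| = |g₁ t x r - g₁ t 0 r| := by
          rw [hg_decomp t ht x hx, hg_decomp t ht 0 h0I, add_sub_add_right_eq_sub]
      _ ≤ |g₁ t x r| + |g₁ t 0 r| := abs_sub _ _
      _ ≤ K * (1 + |r|) + K * (1 + |r|) :=
          add_le_add (hg₁_growth t ht x hx r) (hg₁_growth t ht 0 h0I r)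
      _ = 2 * K * (1 + |r|) := by ring

end IsSkeletonCoefficients

end RightHandSide

theorem mainTheorem4 (T : ℝ) (hT : 0 < T)
    (f g σ g₁ : ℝ → ℝ → ℝ → ℝ) (g₂ : ℝ → ℝ → ℝ) (K L M : ℝ)
    (hf : Measurable fun p : ℝ × ℝ × ℝ => f p.1 p.2.1 p.2.2)
    (hg₁ : Measurable fun p : ℝ × ℝ × ℝ => g₁ p.1 p.2.1 p.2.2)
    (hg₂ : Measurable fun p : ℝ × ℝ => g₂ p.1 p.2)
    (hg : Measurable fun p : ℝ × ℝ × ℝ => g p.1 p.2.1 p.2.2)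
    (hσ : Measurable fun p : ℝ × ℝ × ℝ => σ p.1 p.2.1 p.2.2)
    (hf_growth : ∀ t ∈ Set.Icc 0 T, ∀ x ∈ Set.Icc (0 : ℝ) 1, ∀ r,
      |f t x r| ≤ K * (1 + |r|))
    (hg_decomp : ∀ t ∈ Set.Icc 0 T, ∀ x ∈ Set.Icc (0 : ℝ) 1, ∀ r,
      g t x r = g₁ t x r + g₂ t r)
    (hg₁_growth : ∀ t ∈ Set.Icc 0 T, ∀ x ∈ Set.Icc (0 : ℝ) 1, ∀ r,
      |g₁ t x r| ≤ K * (1 + |r|))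
    (hg₂_growth : ∀ t ∈ Set.Icc 0 T, ∀ r, |g₂ t r| ≤ K * (1 + |r| ^ 2))
    (hσ_bdd : ∀ t ∈ Set.Icc 0 T, ∀ x ∈ Set.Icc (0 : ℝ) 1, ∀ r, |σ t x r| ≤ M)
    (hσ_lip : ∀ t ∈ Set.Icc 0 T, ∀ x ∈ Set.Icc (0 : ℝ) 1, ∀ p q,
      |σ t x p - σ t x q| ≤ L * |p - q|)
    (hf_lip : ∀ t ∈ Set.Icc 0 T, ∀ x ∈ Set.Icc (0 : ℝ) 1, ∀ p q,
      |f t x p - f t x q| ≤ L * (1 + |p| + |q|) * |p - q|)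
    (hg_lip : ∀ t ∈ Set.Icc 0 T, ∀ x ∈ Set.Icc (0 : ℝ) 1, ∀ p q,
      |g t x p - g t x q| ≤ L * (1 + |p| + |q|) * |p - q|)
    (η : L2I) (v : L2TI T) :
    ∃! h : C(Set.Icc (0 : ℝ) T, L2I), IsSkeletonSolution hT.le f g σ η v h := by
  exact (IsSkeletonCoefficients.of_decomposition hT.le hf hg hσ hf_growth hg_decomp hg₁_growth
    hg₂_growth hσ_bdd hσ_lip hf_lip hg_lip).existsUnique_isSkeletonSolution hT.le η v
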